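/- Let $\Omega=I\times J\subset\mathbb R^2$ with $I,J$ nonempty open intervals and coordinates $(u,v)$. Let $\psi:\Omega\to\mathbb R^3$ be a K-net, i.e. a smooth immersion of Gaussian curvature $-1$ whose coordinate fields $E_1=\partial_u$, $E_3=\partial_v$ are unit and asymptotic, and let $\omega\in(0,\pi)$ be the angle between $E_1$ and $E_3$. Let the smooth immersion $\eta:\Omega\to\mathbb R^3$ be a rotation field of $\psi$, i.e. $d\xi=\eta\times d\psi$ for some infinitesimal isometric deformation $\xi$ of $\psi$ (so $\eta$ is a V-net, on a V-surface, with first and second fundamental forms $I_\eta$, $II_\eta$). Let $A=d\psi^{-1}\circ d\eta$, with $b=A_{12}$, $c=A_{21}$ in the frame $(E_1,E_3)$. For a rectangle with vertices $p_{00}=(u_0,v_0)$, $p_{10}=(u_1,v_0)$, $p_{11}=(u_1,v_1)$, $p_{01}=(u_0,v_1)$ ($u_0\le u_1$, $v_0\le v_1$), assume that $\eta$ is alignable: either, for all such rectangles, the $\eta$-images of the broken lines $p_{00}p_{10}p_{11}$ and $p_{00}p_{01}p_{11}$ have equal arc lengths, or, for all such rectangles, those of $p_{10}p_{00}p_{01}$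 and $p_{10}p_{11}p_{01}$ have. Measure coordinate segments also by $l^1=\int c\,du$ and $l^3=\int b\,dv$ (with $u$, $v$ increasing), the forms $c\,du$, $b\,dv$ being dual to the V-frame $(\bar E_1,\bar E_3)=(c^{-1}E_1,b^{-1}E_3)$. Call $\eta$ positive-alignable if $l^1_{p_{00}p_{10}}+l^3_{p_{10}p_{11}}=l^3_{p_{00}p_{01}}+l^1_{p_{01}p_{11}}$ for all such rectangles, and negative-alignable if $l^1_{p_{00}p_{10}}+l^3_{p_{00}p_{01}}=l^3_{p_{10}p_{11}}+l^1_{p_{01}p_{11}}$ for all such rectangles. Then $\eta_u=c\,\psi_v$, $\eta_v=b\,\psi_u$, and $\eta$ is positive-alignable or negative-alignable. There are smooth nowhere vanishing functions $U,V$ on $\Omega$ with $E_3(U)=E_1(V)=0$ such that $Y:=U E_1-V E_3$ satisfies $d\omega(Y)=0$. For every such pair $(U,V)$: (i) if $\eta$ is positive-alignable, there is a constant $C\neq0$ with $(b,c)=\left(\frac CV\csc^2\frac\omega2,\ \frac CU\csc^2\frac\omega2\right)$; (ii) if $\eta$ is negative-alignable, there is a constant $C\neq0$ with $(b,c)=\left(\frac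 CV\sec^2\frac\omega2,\ -\frac CU\sec^2\frac\omega2\right)$; (iii) $E_1(U)=E_3(V)=k$ for a constant $k$, and $E_3(U)=E_1(V)=0$; (iv) if the V-surface is of the first kind, i.e. $\psi$ is helicoidal (some nonzero infinitesimal rigid motion $x\mapsto a\times x+d$ is tangent to $\psi(\Omega)$ everywhere), then $k=0$; if it is of the second kind, i.e. $\psi$ is part of an Amsler surface ($\psi$ extends to a K-net on a rectangle $I'\times J'\supseteq\Omega$, with $I',J'$ open intervals, that maps some coordinate line $v=v_0$ and some coordinate line $u=u_0$ of $I'\times J'$ into straight lines), then $k\ne0$; (v) $\mathcal L_YI_\eta=0$ always; if $k=0$ (in particular for the first kind) then also $\mathcal L_YII_\eta=0$, while if $k\neq0$ (in particular for the second kind) then $\mathcal L_YII_\eta$ vanishes at no point of $\Omega$. -/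

import Mathlib

open scoped ContDiff RealInnerProductSpace

namespace Voss

noncomputable section

/-- Euclidean three-space. -/
abbrev Space : Type := EuclideanSpace ℝ (Fin 3)

/-- The cross product of Euclidean three-space. -/
def cross (x y : Space) : Space := WithLp.toLp 2 (crossProduct x.ofLp y.ofLp)

/-- A nonempty open interval of real numbers (possibly unbounded). -/
def IsOpenInterval (s : Set ℝ) : Prop := s.Nonempty ∧ IsOpen s ∧ s.OrdConnected

/-- The derivative along the first coordinate field `∂u`. -/
def du {F : Type*} [NormedAddCommGroup F] [NormedSpace ℝ F] (f : ℝ × ℝ → F) (p : ℝ × ℝ) : F :=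
  fderiv ℝ f p (1, 0)

/-- The derivative along the second coordinate field `∂v`. -/
def dv {F : Type*} [NormedAddCommGroup F] [NormedSpace ℝ F] (f : ℝ × ℝ → F) (p : ℝ × ℝ) : F :=
  fderiv ℝ f p (0, 1)

/-- A net on the open set `s`: a smooth immersion into three-space. -/
def IsNet (f : ℝ × ℝ → Space) (s : Set (ℝ × ℝ)) : Prop :=
  ContDiffOn ℝ ∞ f s ∧ ∀ p ∈ s, Function.Injective (fderiv ℝ f p)

/-- The first fundamental form. -/
def firstForm (f : ℝ × ℝ → Space) (p X Y : ℝ × ℝ) : ℝ :=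
  ⟪fderiv ℝ f p X, fderiv ℝ f p Y⟫

/-- The unit normal `(f_u × f_v) / ‖f_u × f_v‖`. -/
def unitNormal (f : ℝ × ℝ → Space) (p : ℝ × ℝ) : Space :=
  ‖cross (du f p) (dv f p)‖⁻¹ • cross (du f p) (dv f p)

/-- The second fundamental form. -/
def secondForm (f : ℝ × ℝ → Space) (p X Y : ℝ × ℝ) : ℝ :=
  ⟪fderiv ℝ (fderiv ℝ f) p X Y, unitNormal f p⟫

/-- The Gaussian curvature `det II / det I`. -/
def gaussCurvature (f : ℝ × ℝ → Space) (p : ℝ × ℝ) : ℝ :=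
  (secondForm f p (1, 0) (1, 0) * secondForm f p (0, 1) (0, 1)
      - secondForm f p (1, 0) (0, 1) ^ 2) /
    (firstForm f p (1, 0) (1, 0) * firstForm f p (0, 1) (0, 1)
      - firstForm f p (1, 0) (0, 1) ^ 2)

/-- A K-net: a net of Gaussian curvature `-1` whose coordinate fields `∂u`, `∂v` are unit and
asymptotic, so that `(∂u, ∂v)` is the K-frame `(E₁, E₃)`. -/
def IsKNet (ψ : ℝ × ℝ → Space) (s : Set (ℝ × ℝ)) : Prop :=
  IsNet ψ s ∧ ∀ p ∈ s,
    gaussCurvature ψ p = -1 ∧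
    secondForm ψ p (1, 0) (1, 0) = 0 ∧ secondForm ψ p (0, 1) (0, 1) = 0 ∧
    ‖du ψ p‖ = 1 ∧ ‖dv ψ p‖ = 1

/-- An infinitesimal isometric deformation of `ψ`. -/
def IsInfIsometricDeformation (ψ ξ : ℝ × ℝ → Space) (s : Set (ℝ × ℝ)) : Prop :=
  ContDiffOn ℝ ∞ ξ s ∧ ∀ p ∈ s, ∀ X Y : ℝ × ℝ,
    ⟪fderiv ℝ ξ p X, fderiv ℝ ψ p Y⟫ + ⟪fderiv ℝ ξ p Y, fderiv ℝ ψ p X⟫ = 0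

/-- `η` is a net that is the rotation field of some infinitesimal isometric deformation `ξ`
of `ψ`, that is `dξ = η × dψ`. -/
def IsRotationField (ψ η : ℝ × ℝ → Space) (s : Set (ℝ × ℝ)) : Prop :=
  IsNet η s ∧ ∃ ξ : ℝ × ℝ → Space, IsInfIsometricDeformation ψ ξ s ∧
    ∀ p ∈ s, ∀ X : ℝ × ℝ, fderiv ℝ ξ p X = cross (η p) (fderiv ℝ ψ p X)

/-- The rotation operator `A = dψ⁻¹ ∘ dη` (where `dψ` is injective and the image of `dη` lies in
that of `dψ`). -/
def rotationOperator (ψ η : ℝ × ℝ → Space) (p X : ℝ × ℝ) : ℝ × ℝ :=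
  Function.invFun (fderiv ℝ ψ p) (fderiv ℝ η p X)

/-- The entry `b = A₁₂` of the rotation operator in the frame `(∂u, ∂v)`. -/
def coeffB (ψ η : ℝ × ℝ → Space) (p : ℝ × ℝ) : ℝ := (rotationOperator ψ η p (0, 1)).1

/-- The entry `c = A₂₁` of the rotation operator in the frame `(∂u, ∂v)`. -/
def coeffC (ψ η : ℝ × ℝ → Space) (p : ℝ × ℝ) : ℝ := (rotationOperator ψ η p (1, 0)).2

/-- The angle `ω` between `E₁ = ∂u` and `E₃ = ∂v`. -/
def netAngle (ψ : ℝ × ℝ → Space) (p : ℝ × ℝ) : ℝ :=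
  InnerProductGeometry.angle (du ψ p) (dv ψ p)

/-- Arc length of the `u`-line segment from `(u₀, v)` to `(u₁, v)`. -/
def uLength (η : ℝ × ℝ → Space) (u₀ u₁ v : ℝ) : ℝ := ∫ u in u₀..u₁, ‖du η (u, v)‖

/-- Arc length of the `v`-line segment from `(u, v₀)` to `(u, v₁)`. -/
def vLength (η : ℝ × ℝ → Space) (u v₀ v₁ : ℝ) : ℝ := ∫ v in v₀..v₁, ‖dv η (u, v)‖

/-- A net on `I × J` is alignable if for every net loop `ABCD`, with `A = (u₀, v₀)`,
`B = (u₁, v₀)`, `C = (u₁, v₁)`, `D = (u₀, v₁)`, the two paths joining a pair of opposite vertices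
have the same length; the pair is `A, C` for all loops, or `B, D` for all loops. -/
def IsAlignable (η : ℝ × ℝ → Space) (I J : Set ℝ) : Prop :=
  (∀ u₀ ∈ I, ∀ u₁ ∈ I, ∀ v₀ ∈ J, ∀ v₁ ∈ J, u₀ ≤ u₁ → v₀ ≤ v₁ →
    uLength η u₀ u₁ v₀ + vLength η u₁ v₀ v₁ = vLength η u₀ v₀ v₁ + uLength η u₀ u₁ v₁) ∨
  (∀ u₀ ∈ I, ∀ u₁ ∈ I, ∀ v₀ ∈ J, ∀ v₁ ∈ J, u₀ ≤ u₁ → v₀ ≤ v₁ →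
    uLength η u₀ u₁ v₀ + vLength η u₀ v₀ v₁ = vLength η u₁ v₀ v₁ + uLength η u₀ u₁ v₁)

/-- Length of the segment from `(u₀, v)` to `(u₁, v)`, measured with the form `θ̄¹ = c du` of the
coframe dual to the V-frame `(Ē₁, Ē₃) = (c⁻¹ ∂u, b⁻¹ ∂v)`: the arc length, counted negatively
if `Ē₁` points against `∂u`. -/
def frameLength₁ (ψ η : ℝ × ℝ → Space) (u₀ u₁ v : ℝ) : ℝ := ∫ u in u₀..u₁, coeffC ψ η (u, v)

/-- Length of the segment from `(u, v₀)` to `(u, v₁)`, measured with the form `θ̄³ = b dv` of the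
coframe dual to the V-frame. -/
def frameLength₃ (ψ η : ℝ × ℝ → Space) (u v₀ v₁ : ℝ) : ℝ := ∫ v in v₀..v₁, coeffB ψ η (u, v)

/-- Positive-alignable: `l¹_AB + l³_BC = l³_AD + l¹_DC` for all net loops. -/
def IsPositiveAlignable (ψ η : ℝ × ℝ → Space) (I J : Set ℝ) : Prop :=
  ∀ u₀ ∈ I, ∀ u₁ ∈ I, ∀ v₀ ∈ J, ∀ v₁ ∈ J, u₀ ≤ u₁ → v₀ ≤ v₁ →
    frameLength₁ ψ η u₀ u₁ v₀ + frameLength₃ ψ η u₁ v₀ v₁ =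
      frameLength₃ ψ η u₀ v₀ v₁ + frameLength₁ ψ η u₀ u₁ v₁

/-- Negative-alignable: `l¹_BA + l³_AD = l³_BC + l¹_CD` for all net loops, the `l¹` being
measured for the frame in which `E₁` is replaced by `-E₁`. -/
def IsNegativeAlignable (ψ η : ℝ × ℝ → Space) (I J : Set ℝ) : Prop :=
  ∀ u₀ ∈ I, ∀ u₁ ∈ I, ∀ v₀ ∈ J, ∀ v₁ ∈ J, u₀ ≤ u₁ → v₀ ≤ v₁ →
    frameLength₁ ψ η u₀ u₁ v₀ + frameLength₃ ψ η u₀ v₀ v₁ =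
      frameLength₃ ψ η u₁ v₀ v₁ + frameLength₁ ψ η u₀ u₁ v₁

/-- `U`, `V` are smooth, nowhere vanishing, `E₃(U) = E₁(V) = 0`, and the field
`Y = U E₁ - V E₃` satisfies `dω(Y) = 0`. -/
def IsAngleField (ψ : ℝ × ℝ → Space) (s : Set (ℝ × ℝ)) (U V : ℝ × ℝ → ℝ) : Prop :=
  ContDiffOn ℝ ∞ U s ∧ ContDiffOn ℝ ∞ V s ∧ ∀ p ∈ s,
    U p ≠ 0 ∧ V p ≠ 0 ∧ dv U p = 0 ∧ du V p = 0 ∧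
    fderiv ℝ (netAngle ψ) p (U p, -V p) = 0

/-- The Lie derivative `L_Y T` of a field of bilinear forms, evaluated at `p` on `X`, `Z`. -/
def lieDeriv (Y : ℝ × ℝ → ℝ × ℝ) (T : ℝ × ℝ → ℝ × ℝ → ℝ × ℝ → ℝ) (p X Z : ℝ × ℝ) : ℝ :=
  fderiv ℝ (fun q => T q X Z) p (Y p)
    + T p (fderiv ℝ Y p X) Z + T p X (fderiv ℝ Y p Z)

/-- A helicoidal surface element: invariant under a screw motion, that is, a nonzero infinitesimal
rigid motion `x ↦ a × x + d` is everywhere tangent to the surface. -/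
def IsHelicoidal (ψ : ℝ × ℝ → Space) (s : Set (ℝ × ℝ)) : Prop :=
  ∃ a d : Space, (a ≠ 0 ∨ d ≠ 0) ∧
    ∀ p ∈ s, ∃ X : ℝ × ℝ, fderiv ℝ ψ p X = cross a (ψ p) + d

/-- A K-net on `I × J` that is part of an Amsler surface: it extends to a K-net on a rectangle
containing two straight asymptotic lines, one from each family. They cross in that rectangle,
so they are not parallel. -/
def IsAmsler (ψ : ℝ × ℝ → Space) (I J : Set ℝ) : Prop :=
  ∃ I' J' : Set ℝ, IsOpenInterval I' ∧ IsOpenInterval J' ∧ I ⊆ I' ∧ J ⊆ J' ∧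
    ∃ ψ' : ℝ × ℝ → Space, IsKNet ψ' (I' ×ˢ J') ∧ Set.EqOn ψ ψ' (I ×ˢ J) ∧
      ∃ u₀ ∈ I', ∃ v₀ ∈ J',
        Collinear ℝ ((fun u => ψ' (u, v₀)) '' I') ∧ Collinear ℝ ((fun v => ψ' (u₀, v)) '' J')

end

end Voss

/-!
Write `ω` for the angle of the K-net `ψ`, and `n = ψ_u × ψ_v`. Unit asymptotic coordinates and
curvature `-1` give `ψ_uv = ε n` with a constant sign `ε`, and from this the sine-Gordon equation
`ω_uv = sin ω` (`IsKNet.sine_gordon`). It is used throughout in the following form: since `sin ω`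
has no zeros, a smooth function whose product with `ω_v` vanishes on an open set vanishes there
(`IsKNet.eq_zero_of_mul_dv`).

Integrability of `dξ = η × dψ` and of `dη` forces `η_u = c ψ_v`, `η_v = b ψ_u`
(`IsRotationField.partials_eq_inner`), together with two first order equations for `b`, `c`
(`IsRotationField.coeff_pde`). As `b`, `c` have constant signs, alignability says that
`c_v = σ b_u` with `σ = 1` in the positive and `σ = -1` in the negative case. With
`S = (1 - σ cos ω) / 2`, which is `sin² (ω / 2)` or `cos² (ω / 2)`, the equations then say that
`f = σ c S` depends on `u` alone, `g = b S` on `v` alone, and `g ω_u = f ω_v`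
(`IsRotationField.coeff_mul_halfSq`). So `U = 1 / f`, `V = 1 / g` is an angle field, and every other
one is proportional to it (`IsAngleField.exists_const_mul`).

For an angle field, applying `∂_u ∂_v` to `U ω_u - V ω_v = 0` yields `(U_u - V_v) sin ω = 0`, so
`U_u = V_v` is a constant `k`. The fundamental forms of `η` are
`c² du² + 2 b c cos ω du dv + b² dv²` and `± sin ω (c du² + b dv²)`, while `Y c = -k c` and
`Y b = k b`; hence the first is invariant under `Y`, and the Lie derivative of the second is
`± k sin ω (c du² - b dv²)`.

If `ψ` is helicoidal, the tangent Killing field has constant components in `(∂u, ∂v)` and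
annihilates `ω` (`IsKNet.exists_killing_components`), so it is a multiple of `Y` and `k = 0`. On an
Amsler surface `D = (u - u₀) ω_u - (v - v₀) ω_v` satisfies `D_uv = cos ω D` and vanishes on the two
straight lines, hence everywhere by uniqueness for the Goursat problem (`goursat_unique`); this is
incompatible with `U ω_u = V ω_v` for constant `U`, `V`, so `k ≠ 0`.
-/

namespace Voss

noncomputable section

/-! ### The cross product -/

theorem inner_eq_coord (x y : Space) : ⟪x, y⟫ = x 0 * y 0 + x 1 * y 1 + x 2 * y 2 := by
  simp [PiLp.inner_apply, Fin.sum_univ_three, mul_comm]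

theorem cross_coord (x y : Space) :
    cross x y 0 = x 1 * y 2 - x 2 * y 1 ∧ cross x y 1 = x 2 * y 0 - x 0 * y 2 ∧
      cross x y 2 = x 0 * y 1 - x 1 * y 0 := by
  simp [cross, cross_apply]

theorem space_ext {x y : Space} (h0 : x 0 = y 0) (h1 : x 1 = y 1) (h2 : x 2 = y 2) : x = y := by
  ext i; fin_cases i <;> assumption

theorem inner_cross_left (x y : Space) : ⟪x, cross x y⟫ = 0 := by
  simp only [inner_eq_coord, cross_coord]; ring

theorem inner_cross_right (x y : Space) : ⟪y, cross x y⟫ = 0 := by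
  simp only [inner_eq_coord, cross_coord]; ring

theorem inner_cross_cross (x y z w : Space) :
    ⟪cross x y, cross z w⟫ = ⟪x, z⟫ * ⟪y, w⟫ - ⟪x, w⟫ * ⟪y, z⟫ := by
  simp only [inner_eq_coord, cross_coord]; ring

theorem inner_cross_rotate (x y z : Space) : ⟪x, cross y z⟫ = ⟪z, cross x y⟫ := by
  simp only [inner_eq_coord, cross_coord]; ring

theorem inner_cross_swap (x y z : Space) : ⟪x, cross y z⟫ = -⟪x, cross z y⟫ := by
  simp only [inner_eq_coord, cross_coord]; ring

theorem cross_swap (x y : Space) : cross x y = -cross y x := by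
  apply space_ext <;> simp [cross_coord] <;> ring

theorem cross_smul_smul (a b : ℝ) (x y : Space) :
    cross (a • x) (b • y) = (a * b) • cross x y := by
  apply space_ext <;> simp only [cross_coord, PiLp.smul_apply, smul_eq_mul] <;> ring

/-- Expansion of a vector in the frame `x, y, x × y` by its inner products with that frame. -/
theorem frame_expansion (x y z : Space) :
    (⟪x, x⟫ * ⟪y, y⟫ - ⟪x, y⟫ ^ 2) • z =
      (⟪y, y⟫ * ⟪z, x⟫ - ⟪x, y⟫ * ⟪z, y⟫) • x + (⟪x, x⟫ * ⟪z, y⟫ - ⟪x, y⟫ * ⟪z, x⟫) • y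
        + ⟪z, cross x y⟫ • cross x y := by
  apply space_ext <;>
  simp only [inner_eq_coord, cross_coord, PiLp.add_apply, PiLp.smul_apply, smul_eq_mul] <;> ring

/-- The cross product as a continuous bilinear map. -/
def crossL : Space →L[ℝ] Space →L[ℝ] Space :=
  (LinearMap.mk₂ ℝ cross
    (fun x y z => by
      apply space_ext <;> simp only [cross_coord, PiLp.add_apply] <;> ring)
    (fun a x y => by
      apply space_ext <;> simp only [cross_coord, PiLp.smul_apply, smul_eq_mul] <;> ring)
    (fun x y z => by
      apply space_ext <;> simp only [cross_coord, PiLp.add_apply] <;> ring)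
    (fun a x y => by
      apply space_ext <;>
        simp only [cross_coord, PiLp.smul_apply, smul_eq_mul] <;> ring)).toContinuousBilinearMap

theorem crossL_apply (x y : Space) : crossL x y = cross x y := rfl

theorem cross_smul_left (a : ℝ) (x y : Space) : cross (a • x) y = a • cross x y := by
  simp [← crossL_apply]

theorem cross_zero_left (x : Space) : cross 0 x = 0 := by
  simp [← crossL_apply]

/-! ### Partial derivatives -/

section Calculus

variable {E F : Type*} [NormedAddCommGroup E] [NormedSpace ℝ E]
  [NormedAddCommGroup F] [InnerProductSpace ℝ F]
  {p : ℝ × ℝ}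

theorem fderiv_apply_eq (f : ℝ × ℝ → E) (p X : ℝ × ℝ) :
    fderiv ℝ f p X = X.1 • du f p + X.2 • dv f p := by
  have : X = X.1 • ((1, 0) : ℝ × ℝ) + X.2 • ((0, 1) : ℝ × ℝ) := by ext <;> simp
  conv_lhs => rw [this]
  simp only [map_add, map_smul, du, dv]

theorem du_const (c : E) : du (fun _ => c) p = 0 := by simp [du]
theorem dv_const (c : E) : dv (fun _ => c) p = 0 := by simp [dv]

theorem du_add {f g : ℝ × ℝ → E} (hf : DifferentiableAt ℝ f p) (hg : DifferentiableAt ℝ g p) :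
    du (fun q => f q + g q) p = du f p + du g p := by simp [du, fderiv_fun_add hf hg]
theorem dv_add {f g : ℝ × ℝ → E} (hf : DifferentiableAt ℝ f p) (hg : DifferentiableAt ℝ g p) :
    dv (fun q => f q + g q) p = dv f p + dv g p := by simp [dv, fderiv_fun_add hf hg]

theorem du_sub {f g : ℝ × ℝ → E} (hf : DifferentiableAt ℝ f p) (hg : DifferentiableAt ℝ g p) :
    du (fun q => f q - g q) p = du f p - du g p := by simp [du, fderiv_fun_sub hf hg]
theorem dv_sub {f g : ℝ × ℝ → E} (hf : DifferentiableAt ℝ f p) (hg : DifferentiableAt ℝ g p) :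
    dv (fun q => f q - g q) p = dv f p - dv g p := by simp [dv, fderiv_fun_sub hf hg]

theorem du_neg {f : ℝ × ℝ → E} : du (fun q => -f q) p = -du f p := by simp [du]
theorem dv_neg {f : ℝ × ℝ → E} : dv (fun q => -f q) p = -dv f p := by simp [dv]

theorem du_smul {f : ℝ × ℝ → ℝ} {g : ℝ × ℝ → E} (hf : DifferentiableAt ℝ f p)
    (hg : DifferentiableAt ℝ g p) :
    du (fun q => f q • g q) p = du f p • g p + f p • du g p := by
  simp [du, fderiv_fun_smul hf hg, add_comm]
theorem dv_smul {f : ℝ × ℝ → ℝ} {g : ℝ × ℝ → E} (hf : DifferentiableAt ℝ f p)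
    (hg : DifferentiableAt ℝ g p) :
    dv (fun q => f q • g q) p = dv f p • g p + f p • dv g p := by
  simp [dv, fderiv_fun_smul hf hg, add_comm]

theorem du_mul {f g : ℝ × ℝ → ℝ} (hf : DifferentiableAt ℝ f p) (hg : DifferentiableAt ℝ g p) :
    du (fun q => f q * g q) p = du f p * g p + f p * du g p := du_smul hf hg
theorem dv_mul {f g : ℝ × ℝ → ℝ} (hf : DifferentiableAt ℝ f p) (hg : DifferentiableAt ℝ g p) :
    dv (fun q => f q * g q) p = dv f p * g p + f p * dv g p := dv_smul hf hg

theorem du_inner {f g : ℝ × ℝ → F} (hf : DifferentiableAt ℝ f p) (hg : DifferentiableAt ℝ g p) :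
    du (fun q => ⟪f q, g q⟫) p = ⟪du f p, g p⟫ + ⟪f p, du g p⟫ := by
  rw [du, fderiv_inner_apply ℝ hf hg, add_comm]; rfl
theorem dv_inner {f g : ℝ × ℝ → F} (hf : DifferentiableAt ℝ f p) (hg : DifferentiableAt ℝ g p) :
    dv (fun q => ⟪f q, g q⟫) p = ⟪dv f p, g p⟫ + ⟪f p, dv g p⟫ := by
  rw [dv, fderiv_inner_apply ℝ hf hg, add_comm]; rfl

theorem du_cross {f g : ℝ × ℝ → Space} (hf : DifferentiableAt ℝ f p)
    (hg : DifferentiableAt ℝ g p) :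
    du (fun q => cross (f q) (g q)) p = cross (du f p) (g p) + cross (f p) (du g p) := by
  have := crossL.hasFDerivAt_of_bilinear hf.hasFDerivAt hg.hasFDerivAt
  simp only [crossL_apply] at this
  rw [du, this.fderiv, add_comm]; rfl
theorem dv_cross {f g : ℝ × ℝ → Space} (hf : DifferentiableAt ℝ f p)
    (hg : DifferentiableAt ℝ g p) :
    dv (fun q => cross (f q) (g q)) p = cross (dv f p) (g p) + cross (f p) (dv g p) := by
  have := crossL.hasFDerivAt_of_bilinear hf.hasFDerivAt hg.hasFDerivAt
  simp only [crossL_apply] at this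
  rw [dv, this.fderiv, add_comm]; rfl

theorem du_cos {f : ℝ × ℝ → ℝ} (hf : DifferentiableAt ℝ f p) :
    du (fun q => Real.cos (f q)) p = -Real.sin (f p) * du f p := by
  simp [du, fderiv_cos hf]
theorem dv_cos {f : ℝ × ℝ → ℝ} (hf : DifferentiableAt ℝ f p) :
    dv (fun q => Real.cos (f q)) p = -Real.sin (f p) * dv f p := by
  simp [dv, fderiv_cos hf]

theorem du_sin {f : ℝ × ℝ → ℝ} (hf : DifferentiableAt ℝ f p) :
    du (fun q => Real.sin (f q)) p = Real.cos (f p) * du f p := by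
  simp [du, fderiv_sin hf]
theorem dv_sin {f : ℝ × ℝ → ℝ} (hf : DifferentiableAt ℝ f p) :
    dv (fun q => Real.sin (f q)) p = Real.cos (f p) * dv f p := by
  simp [dv, fderiv_sin hf]

theorem du_fst (c : ℝ) : du (fun q : ℝ × ℝ => q.1 - c) p = 1 := by
  rw [du, ((hasFDerivAt_fst (𝕜 := ℝ) (p := p)).sub_const c).fderiv]; rfl
theorem dv_fst (c : ℝ) : dv (fun q : ℝ × ℝ => q.1 - c) p = 0 := by
  rw [dv, ((hasFDerivAt_fst (𝕜 := ℝ) (p := p)).sub_const c).fderiv]; rfl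
theorem du_snd (c : ℝ) : du (fun q : ℝ × ℝ => q.2 - c) p = 0 := by
  rw [du, ((hasFDerivAt_snd (𝕜 := ℝ) (p := p)).sub_const c).fderiv]; rfl
theorem dv_snd (c : ℝ) : dv (fun q : ℝ × ℝ => q.2 - c) p = 1 := by
  rw [dv, ((hasFDerivAt_snd (𝕜 := ℝ) (p := p)).sub_const c).fderiv]; rfl

variable {s : Set (ℝ × ℝ)}

theorem fderiv_congr_of_eqOn (hs : IsOpen s) {f g : ℝ × ℝ → E} (h : ∀ q ∈ s, f q = g q)
    (hp : p ∈ s) : fderiv ℝ f p = fderiv ℝ g p :=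
  Filter.EventuallyEq.fderiv_eq (Filter.eventuallyEq_of_mem (hs.mem_nhds hp) h)

theorem du_congr (hs : IsOpen s) {f g : ℝ × ℝ → E} (h : ∀ q ∈ s, f q = g q)
    (hp : p ∈ s) : du f p = du g p := by rw [du, fderiv_congr_of_eqOn hs h hp]; rfl
theorem dv_congr (hs : IsOpen s) {f g : ℝ × ℝ → E} (h : ∀ q ∈ s, f q = g q)
    (hp : p ∈ s) : dv f p = dv g p := by rw [dv, fderiv_congr_of_eqOn hs h hp]; rfl

theorem diffAt (hs : IsOpen s) {f : ℝ × ℝ → E} (hf : ContDiffOn ℝ ∞ f s) (hp : p ∈ s) :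
    DifferentiableAt ℝ f p :=
  (hf.contDiffAt (hs.mem_nhds hp)).differentiableAt (by simp)

theorem contDiffOn_fderiv_apply (hs : IsOpen s) {f : ℝ × ℝ → E} (hf : ContDiffOn ℝ ∞ f s)
    (X : ℝ × ℝ) : ContDiffOn ℝ ∞ (fun q => fderiv ℝ f q X) s :=
  (hf.fderiv_of_isOpen hs (m := ∞) (by simp)).clm_apply contDiffOn_const

theorem contDiffOn_du (hs : IsOpen s) {f : ℝ × ℝ → E} (hf : ContDiffOn ℝ ∞ f s) :
    ContDiffOn ℝ ∞ (du f) s := contDiffOn_fderiv_apply hs hf (1, 0)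
theorem contDiffOn_dv (hs : IsOpen s) {f : ℝ × ℝ → E} (hf : ContDiffOn ℝ ∞ f s) :
    ContDiffOn ℝ ∞ (dv f) s := contDiffOn_fderiv_apply hs hf (0, 1)

theorem contDiffOn_cross {f g : ℝ × ℝ → Space} (hf : ContDiffOn ℝ ∞ f s)
    (hg : ContDiffOn ℝ ∞ g s) : ContDiffOn ℝ ∞ (fun q => cross (f q) (g q)) s :=
  (crossL.contDiff.comp_contDiffOn hf).clm_apply hg

/-- The second derivative as an iterated directional derivative. -/
theorem fderiv_fderiv_apply (hs : IsOpen s) {f : ℝ × ℝ → E} (hf : ContDiffOn ℝ ∞ f s)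
    (hp : p ∈ s) (X Y : ℝ × ℝ) :
    fderiv ℝ (fderiv ℝ f) p X Y = fderiv ℝ (fun q => fderiv ℝ f q Y) p X := by
  have h1 : DifferentiableAt ℝ (fderiv ℝ f) p :=
    ((hf.fderiv_of_isOpen hs (m := ∞) (by simp)).contDiffAt
      (hs.mem_nhds hp)).differentiableAt (by simp)
  rw [fderiv_clm_apply h1 (differentiableAt_const Y)]
  simp

theorem dv_du_eq (hs : IsOpen s) {f : ℝ × ℝ → E} (hf : ContDiffOn ℝ ∞ f s) (hp : p ∈ s) :
    dv (du f) p = du (dv f) p := by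
  have h := (hf.contDiffAt (hs.mem_nhds hp)).isSymmSndFDerivAt
    (by rw [minSmoothness_of_isRCLikeNormedField]; exact ENat.LEInfty.out)
  have := h.eq (0, 1) (1, 0)
  rw [fderiv_fderiv_apply hs hf hp, fderiv_fderiv_apply hs hf hp] at this
  exact this

theorem exists_const_of_partials_eq_zero (hs : IsOpen s) (hc : IsPreconnected s)
    {f : ℝ × ℝ → ℝ} (hf : ContDiffOn ℝ ∞ f s) (hu : ∀ q ∈ s, du f q = 0)
    (hv : ∀ q ∈ s, dv f q = 0) : ∃ C, ∀ q ∈ s, f q = C := by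
  refine hs.exists_is_const_of_fderiv_eq_zero (𝕜 := ℝ) hc (hf.differentiableOn (by simp)) ?_
  intro q hq
  ext
  · simpa [du] using hu q hq
  · simpa [dv] using hv q hq

end Calculus

/-! ### Rectangles -/

theorem IsOpenInterval.isOpen_prod {I J : Set ℝ} (hI : IsOpenInterval I) (hJ : IsOpenInterval J) :
    IsOpen (I ×ˢ J) := hI.2.1.prod hJ.2.1

theorem IsOpenInterval.isPreconnected_prod {I J : Set ℝ} (hI : IsOpenInterval I)
    (hJ : IsOpenInterval J) : IsPreconnected (I ×ˢ J) :=
  hI.2.2.isPreconnected.prod hJ.2.2.isPreconnected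

/-! ### K-nets and the sine-Gordon equation -/

section KNet

variable {ψ : ℝ × ℝ → Space} {s : Set (ℝ × ℝ)} {p : ℝ × ℝ}

theorem IsKNet.smooth (h : IsKNet ψ s) : ContDiffOn ℝ ∞ ψ s := h.1.1

theorem IsKNet.inner_du_du (h : IsKNet ψ s) (hp : p ∈ s) : ⟪du ψ p, du ψ p⟫ = 1 := by
  rw [real_inner_self_eq_norm_sq, (h.2 p hp).2.2.2.1]; norm_num

theorem IsKNet.inner_dv_dv (h : IsKNet ψ s) (hp : p ∈ s) : ⟪dv ψ p, dv ψ p⟫ = 1 := by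
  rw [real_inner_self_eq_norm_sq, (h.2 p hp).2.2.2.2]; norm_num

theorem IsKNet.inner_du_dv (h : IsKNet ψ s) (hp : p ∈ s) :
    ⟪du ψ p, dv ψ p⟫ = Real.cos (netAngle ψ p) := by
  rw [netAngle, InnerProductGeometry.cos_angle, (h.2 p hp).2.2.2.1, (h.2 p hp).2.2.2.2]; simp

theorem IsKNet.sin_pos (h : IsKNet ψ s) (hp : p ∈ s) : 0 < Real.sin (netAngle ψ p) := by
  refine lt_of_le_of_ne
    (Real.sin_nonneg_of_nonneg_of_le_pi (InnerProductGeometry.angle_nonneg _ _)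
      (InnerProductGeometry.angle_le_pi _ _)) fun h0 => ?_
  -- A degenerate first fundamental form would give the junk value `x / 0 = 0` for the curvature.
  have hK := (h.2 p hp).1
  have h1 : firstForm ψ p (1, 0) (1, 0) = 1 := h.inner_du_du hp
  have h2 : firstForm ψ p (0, 1) (0, 1) = 1 := h.inner_dv_dv hp
  have h3 : firstForm ψ p (1, 0) (0, 1) = Real.cos (netAngle ψ p) := h.inner_du_dv hp
  have h4 := Real.sin_sq_add_cos_sq (netAngle ψ p)
  rw [← h0] at h4
  have h5 : (1 : ℝ) * 1 - Real.cos (netAngle ψ p) ^ 2 = 0 := by linarith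
  rw [gaussCurvature, h1, h2, h3, h5, div_zero] at hK
  norm_num at hK

theorem IsKNet.netAngle_pos (h : IsKNet ψ s) (hp : p ∈ s) : 0 < netAngle ψ p :=
  lt_of_le_of_ne (InnerProductGeometry.angle_nonneg _ _) fun h0 => by
    have := h.sin_pos hp
    rw [← h0] at this; simp at this

theorem IsKNet.netAngle_lt_pi (h : IsKNet ψ s) (hp : p ∈ s) : netAngle ψ p < Real.pi :=
  lt_of_le_of_ne (InnerProductGeometry.angle_le_pi _ _) fun h0 => by
    have := h.sin_pos hp
    rw [h0] at this; simp at this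

theorem IsKNet.sin_half_pos (h : IsKNet ψ s) (hp : p ∈ s) :
    0 < Real.sin (netAngle ψ p / 2) :=
  Real.sin_pos_of_pos_of_lt_pi (by linarith [h.netAngle_pos hp])
    (by linarith [h.netAngle_lt_pi hp, h.netAngle_pos hp])

theorem IsKNet.cos_half_pos (h : IsKNet ψ s) (hp : p ∈ s) :
    0 < Real.cos (netAngle ψ p / 2) :=
  Real.cos_pos_of_mem_Ioo
    ⟨by linarith [h.netAngle_pos hp, Real.pi_pos], by linarith [h.netAngle_lt_pi hp]⟩

theorem IsKNet.contDiffOn_netAngle (hs : IsOpen s) (h : IsKNet ψ s) :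
    ContDiffOn ℝ ∞ (netAngle ψ) s := by
  have hsm : ContDiffOn ℝ ∞ (fun q => ⟪du ψ q, dv ψ q⟫) s :=
    (contDiffOn_du hs h.smooth).inner ℝ (contDiffOn_dv hs h.smooth)
  have heq : ∀ q ∈ s, netAngle ψ q = Real.arccos ⟪du ψ q, dv ψ q⟫ := by
    intro q hq
    rw [h.inner_du_dv hq, Real.arccos_cos (h.netAngle_pos hq).le (h.netAngle_lt_pi hq).le]
  refine ContDiffOn.congr ?_ heq
  intro q hq
  have hne : ⟪du ψ q, dv ψ q⟫ ≠ -1 ∧ ⟪du ψ q, dv ψ q⟫ ≠ 1 := by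
    have h1 := h.sin_pos hq
    have h2 := Real.sin_sq_add_cos_sq (netAngle ψ q)
    rw [h.inner_du_dv hq]
    constructor <;> intro h3 <;> rw [h3] at h2 <;> nlinarith
  exact ContDiffAt.comp_contDiffWithinAt (g := Real.arccos) q
    (Real.contDiffAt_arccos hne.1 hne.2) (hsm q hq)

/-- A function of square one on a connected set is a constant sign. -/
theorem exists_const_sign (hc : IsPreconnected s) {f : ℝ × ℝ → ℝ} (hf : ContinuousOn f s)
    (h1 : ∀ q ∈ s, f q ^ 2 = 1) : ∃ ε : ℝ, ε ^ 2 = 1 ∧ ∀ q ∈ s, f q = ε := by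
  rcases hc.eq_one_or_eq_neg_one_of_sq_eq hf (fun q hq => h1 q hq) with h | h
  · exact ⟨1, by norm_num, fun q hq => h hq⟩
  · exact ⟨-1, by norm_num, fun q hq => h hq⟩

/-- A nowhere vanishing function on a connected set has a constant sign `τ`. -/
theorem exists_const_sign_abs (hc : IsPreconnected s) {f : ℝ × ℝ → ℝ} (hf : ContinuousOn f s)
    (h0 : ∀ q ∈ s, f q ≠ 0) : ∃ τ : ℝ, τ ^ 2 = 1 ∧ ∀ q ∈ s, |f q| = τ * f q := by
  obtain ⟨τ, h1, h2⟩ := exists_const_sign hc (f := fun q => |f q| / f q)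
    (hf.abs.div hf h0) (fun q hq => by rw [div_pow, sq_abs, div_self (pow_ne_zero 2 (h0 q hq))])
  exact ⟨τ, h1, fun q hq => by rw [← h2 q hq, div_mul_cancel₀ _ (h0 q hq)]⟩

theorem IsKNet.diffAt_du (hs : IsOpen s) (h : IsKNet ψ s) (hp : p ∈ s) :
    DifferentiableAt ℝ (du ψ) p := diffAt hs (contDiffOn_du hs h.smooth) hp

theorem IsKNet.diffAt_dv (hs : IsOpen s) (h : IsKNet ψ s) (hp : p ∈ s) :
    DifferentiableAt ℝ (dv ψ) p := diffAt hs (contDiffOn_dv hs h.smooth) hp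

theorem IsKNet.diffAt_netAngle (hs : IsOpen s) (h : IsKNet ψ s) (hp : p ∈ s) :
    DifferentiableAt ℝ (netAngle ψ) p := diffAt hs (h.contDiffOn_netAngle hs) hp

/-- The inner products of the second derivatives of `ψ` with `ψ_u` and `ψ_v`. -/
theorem IsKNet.inner_second (hs : IsOpen s) (h : IsKNet ψ s) (hp : p ∈ s) :
    ⟪du (du ψ) p, du ψ p⟫ = 0 ∧ ⟪du (dv ψ) p, du ψ p⟫ = 0 ∧
    ⟪du (dv ψ) p, dv ψ p⟫ = 0 ∧ ⟪dv (dv ψ) p, dv ψ p⟫ = 0 ∧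
    ⟪du (du ψ) p, dv ψ p⟫ = -Real.sin (netAngle ψ p) * du (netAngle ψ) p ∧
    ⟪dv (dv ψ) p, du ψ p⟫ = -Real.sin (netAngle ψ p) * dv (netAngle ψ) p := by
  have hP := h.diffAt_du hs hp
  have hQ := h.diffAt_dv hs hp
  have hω := h.diffAt_netAngle hs hp
  have hPQ := dv_du_eq hs h.smooth hp
  have a1 := du_congr hs (fun q hq => h.inner_du_du hq) hp
  have a2 := dv_congr hs (fun q hq => h.inner_du_du hq) hp
  have a3 := du_congr hs (fun q hq => h.inner_dv_dv hq) hp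
  have a4 := dv_congr hs (fun q hq => h.inner_dv_dv hq) hp
  have a5 := du_congr hs (fun q hq => h.inner_du_dv hq) hp
  have a6 := dv_congr hs (fun q hq => h.inner_du_dv hq) hp
  rw [du_inner hP hP, du_const, real_inner_comm (du (du ψ) p) (du ψ p)] at a1
  rw [dv_inner hP hP, dv_const, real_inner_comm (dv (du ψ) p) (du ψ p), hPQ] at a2
  rw [du_inner hQ hQ, du_const, real_inner_comm (du (dv ψ) p) (dv ψ p)] at a3
  rw [dv_inner hQ hQ, dv_const, real_inner_comm (dv (dv ψ) p) (dv ψ p)] at a4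
  rw [du_inner hP hQ, du_cos hω, real_inner_comm (du (dv ψ) p) (du ψ p)] at a5
  rw [dv_inner hP hQ, dv_cos hω, hPQ, real_inner_comm (dv (dv ψ) p) (du ψ p)] at a6
  have b2 : ⟪du (dv ψ) p, du ψ p⟫ = 0 := by linarith
  have b3 : ⟪du (dv ψ) p, dv ψ p⟫ = 0 := by linarith
  exact ⟨by linarith, b2, b3, by linarith, by linarith, by linarith⟩

theorem IsKNet.inner_normal (h : IsKNet ψ s) (hp : p ∈ s) :
    ⟪cross (du ψ p) (dv ψ p), cross (du ψ p) (dv ψ p)⟫ = Real.sin (netAngle ψ p) ^ 2 := by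
  rw [inner_cross_cross, h.inner_du_du hp, h.inner_dv_dv hp, real_inner_comm (du ψ p),
    h.inner_du_dv hp]
  rw [Real.sin_sq]; ring

theorem IsKNet.norm_normal (h : IsKNet ψ s) (hp : p ∈ s) :
    ‖cross (du ψ p) (dv ψ p)‖ = Real.sin (netAngle ψ p) := by
  rw [← pow_left_inj₀ (norm_nonneg _) (h.sin_pos hp).le two_ne_zero,
    ← real_inner_self_eq_norm_sq, h.inner_normal hp]

/-- Expansion of a vector in the frame `ψ_u`, `ψ_v`, `ψ_u × ψ_v`. -/
theorem IsKNet.expansion (h : IsKNet ψ s) (hp : p ∈ s) (z : Space) :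
    Real.sin (netAngle ψ p) ^ 2 • z =
      (⟪z, du ψ p⟫ - Real.cos (netAngle ψ p) * ⟪z, dv ψ p⟫) • du ψ p
        + (⟪z, dv ψ p⟫ - Real.cos (netAngle ψ p) * ⟪z, du ψ p⟫) • dv ψ p
        + ⟪z, cross (du ψ p) (dv ψ p)⟫ • cross (du ψ p) (dv ψ p) := by
  have := frame_expansion (du ψ p) (dv ψ p) z
  rw [h.inner_du_du hp, h.inner_dv_dv hp, h.inner_du_dv hp] at this
  rw [Real.sin_sq]
  simpa only [one_mul] using this

/-- A vector is determined by its inner products with `ψ_u`, `ψ_v` and the normal. -/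
theorem IsKNet.ext_inner (h : IsKNet ψ s) (hp : p ∈ s) {z w : Space}
    (h1 : ⟪z, du ψ p⟫ = ⟪w, du ψ p⟫) (h2 : ⟪z, dv ψ p⟫ = ⟪w, dv ψ p⟫)
    (h3 : ⟪z, cross (du ψ p) (dv ψ p)⟫ = ⟪w, cross (du ψ p) (dv ψ p)⟫) : z = w := by
  have e1 := h.expansion hp z
  rw [h1, h2, h3, ← h.expansion hp w] at e1
  exact smul_right_injective _ (pow_ne_zero 2 (h.sin_pos hp).ne') e1

theorem secondForm_eq (hs : IsOpen s) (h : ContDiffOn ℝ ∞ ψ s) (hp : p ∈ s) :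
    secondForm ψ p (1, 0) (1, 0) = ⟪du (du ψ) p, unitNormal ψ p⟫ ∧
    secondForm ψ p (1, 0) (0, 1) = ⟪du (dv ψ) p, unitNormal ψ p⟫ ∧
    secondForm ψ p (0, 1) (0, 1) = ⟪dv (dv ψ) p, unitNormal ψ p⟫ := by
  refine ⟨?_, ?_, ?_⟩ <;> rw [secondForm, fderiv_fderiv_apply hs h hp] <;> rfl

theorem IsKNet.inner_second_normal (hs : IsOpen s) (h : IsKNet ψ s) (hp : p ∈ s) :
    ⟪du (du ψ) p, cross (du ψ p) (dv ψ p)⟫ = 0 ∧ ⟪dv (dv ψ) p, cross (du ψ p) (dv ψ p)⟫ = 0 ∧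
    ⟪du (dv ψ) p, cross (du ψ p) (dv ψ p)⟫ ^ 2 = (Real.sin (netAngle ψ p) ^ 2) ^ 2 := by
  obtain ⟨hK, h1, h2, -, -⟩ := h.2 p hp
  obtain ⟨e1, e2, e3⟩ := secondForm_eq hs h.smooth hp
  have hs0 := (h.sin_pos hp).ne'
  have i1 : firstForm ψ p (1, 0) (1, 0) = 1 := h.inner_du_du hp
  have i2 : firstForm ψ p (0, 1) (0, 1) = 1 := h.inner_dv_dv hp
  have i3 : firstForm ψ p (1, 0) (0, 1) = Real.cos (netAngle ψ p) := h.inner_du_dv hp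
  have hden : (1 : ℝ) * 1 - Real.cos (netAngle ψ p) ^ 2 = Real.sin (netAngle ψ p) ^ 2 := by
    rw [Real.sin_sq]; ring
  rw [gaussCurvature, h1, h2, e2, i1, i2, i3, hden] at hK
  rw [e1] at h1
  rw [e3] at h2
  rw [unitNormal, h.norm_normal hp, inner_smul_right] at hK h1 h2
  refine ⟨by simpa [hs0] using h1, by simpa [hs0] using h2, ?_⟩
  field_simp at hK
  linarith

/-- The orientation sign `ε` of the net: `ψ_uv = ε ψ_u × ψ_v`. -/
theorem IsKNet.exists_sign (hs : IsOpen s) (hc : IsPreconnected s) (h : IsKNet ψ s) :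
    ∃ ε : ℝ, ε ^ 2 = 1 ∧ ∀ q ∈ s, du (dv ψ) q = ε • cross (du ψ q) (dv ψ q) := by
  have hP := contDiffOn_du hs h.smooth
  have hQ := contDiffOn_dv hs h.smooth
  have hnum : ContinuousOn (fun q => ⟪du (dv ψ) q, cross (du ψ q) (dv ψ q)⟫) s :=
    (ContDiffOn.inner ℝ (contDiffOn_du hs hQ) (contDiffOn_cross hP hQ)).continuousOn
  have hden : ContinuousOn (fun q => Real.sin (netAngle ψ q) ^ 2) s :=
    ((h.contDiffOn_netAngle hs).sin.pow 2).continuousOn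
  obtain ⟨ε, h1, h2⟩ := exists_const_sign hc
    (f := fun q => ⟪du (dv ψ) q, cross (du ψ q) (dv ψ q)⟫ / Real.sin (netAngle ψ q) ^ 2)
    (hnum.div hden fun q hq => pow_ne_zero 2 (h.sin_pos hq).ne')
    (fun q hq => by
      rw [div_pow, (h.inner_second_normal hs hq).2.2,
        div_self (pow_ne_zero 2 (pow_ne_zero 2 (h.sin_pos hq).ne'))])
  refine ⟨ε, h1, fun q hq => h.ext_inner hq ?_ ?_ ?_⟩
  · rw [(h.inner_second hs hq).2.1, inner_smul_left, real_inner_comm, inner_cross_left, mul_zero]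
  · rw [(h.inner_second hs hq).2.2.1, inner_smul_left, real_inner_comm, inner_cross_right,
      mul_zero]
  · rw [inner_smul_left, h.inner_normal hq, ← h2 q hq]
    simp [div_mul_cancel₀ _ (pow_ne_zero 2 (h.sin_pos hq).ne')]

/-- The Gauss formulas for `ψ_uu` and `ψ_vv`. -/
theorem IsKNet.gauss_formulas (hs : IsOpen s) (h : IsKNet ψ s) (hp : p ∈ s) :
    Real.sin (netAngle ψ p) • du (du ψ) p =
      -du (netAngle ψ) p • (dv ψ p - Real.cos (netAngle ψ p) • du ψ p) ∧
    Real.sin (netAngle ψ p) • dv (dv ψ) p =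
      -dv (netAngle ψ) p • (du ψ p - Real.cos (netAngle ψ p) • dv ψ p) := by
  obtain ⟨a1, a2, a3, a4, a5, a6⟩ := h.inner_second hs hp
  obtain ⟨n1, n2, -⟩ := h.inner_second_normal hs hp
  have hQP : ⟪dv ψ p, du ψ p⟫ = Real.cos (netAngle ψ p) := by
    rw [real_inner_comm, h.inner_du_dv hp]
  constructor <;> apply h.ext_inner hp <;>
    simp only [inner_smul_left, inner_sub_left, h.inner_du_du hp, h.inner_dv_dv hp,
      h.inner_du_dv hp, hQP, a1, a4, a5, a6, n1, n2, inner_cross_left, inner_cross_right,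
      conj_trivial] <;>
    first
    | ring1
    | linear_combination (-du (netAngle ψ) p) * Real.sin_sq_add_cos_sq (netAngle ψ p)
    | linear_combination (-dv (netAngle ψ) p) * Real.sin_sq_add_cos_sq (netAngle ψ p)

/-- The sine-Gordon equation `ω_uv = sin ω`: two expressions for `(ψ_u · ψ_v)_uv`. -/
theorem IsKNet.sine_gordon (hs : IsOpen s) (hc : IsPreconnected s) (h : IsKNet ψ s)
    (hp : p ∈ s) : dv (du (netAngle ψ)) p = Real.sin (netAngle ψ p) := by
  have hω := h.contDiffOn_netAngle hs
  have hP := contDiffOn_du hs h.smooth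
  have hQ := contDiffOn_dv hs h.smooth
  have hPu := contDiffOn_du hs hP
  have hQu := contDiffOn_du hs hQ
  have hs0 := h.sin_pos hp
  obtain ⟨ε, hε, hsign⟩ := h.exists_sign hs hc
  have e1 := dv_congr hs (fun q hq => (h.inner_second hs hq).2.2.2.2.1) hp
  rw [dv_inner (diffAt hs hPu hp) (diffAt hs hQ hp),
    dv_mul (diffAt hs hω.sin.neg hp) (diffAt hs (contDiffOn_du hs hω) hp), dv_neg,
    dv_sin (diffAt hs hω hp), dv_du_eq hs hP hp,
    du_congr hs (fun q hq => dv_du_eq hs h.smooth hq) hp] at e1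
  have e2 := du_congr hs (fun q hq => (h.inner_second hs hq).2.2.1) hp
  rw [du_inner (diffAt hs hQu hp) (diffAt hs hQ hp), du_const] at e2
  have e3 : ⟪du (dv ψ) p, du (dv ψ) p⟫ = Real.sin (netAngle ψ p) ^ 2 := by
    rw [hsign p hp, inner_smul_left, inner_smul_right, h.inner_normal hp]
    simp only [conj_trivial]
    linear_combination Real.sin (netAngle ψ p) ^ 2 * hε
  obtain ⟨g1, g2⟩ := h.gauss_formulas hs hp
  have hQP : ⟪dv ψ p, du ψ p⟫ = Real.cos (netAngle ψ p) := by
    rw [real_inner_comm, h.inner_du_dv hp]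
  have e4 : Real.sin (netAngle ψ p) ^ 2 * ⟪du (du ψ) p, dv (dv ψ) p⟫ =
      Real.sin (netAngle ψ p) ^ 2 *
        (-Real.cos (netAngle ψ p) * du (netAngle ψ) p * dv (netAngle ψ) p) := by
    have : Real.sin (netAngle ψ p) ^ 2 * ⟪du (du ψ) p, dv (dv ψ) p⟫ =
        ⟪Real.sin (netAngle ψ p) • du (du ψ) p, Real.sin (netAngle ψ p) • dv (dv ψ) p⟫ := by
      rw [inner_smul_left, inner_smul_right]; simp only [conj_trivial]; ring
    rw [this, g1, g2]
    simp only [inner_smul_left, inner_smul_right, inner_sub_left, inner_sub_right,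
      h.inner_du_du hp, h.inner_dv_dv hp, h.inner_du_dv hp, hQP, conj_trivial]
    linear_combination (du (netAngle ψ) p * dv (netAngle ψ) p * Real.cos (netAngle ψ p)) *
      Real.sin_sq_add_cos_sq (netAngle ψ p)
  have e5 := mul_left_cancel₀ (pow_ne_zero 2 hs0.ne') e4
  apply mul_left_cancel₀ hs0.ne'
  linear_combination e1 - e2 + e3 - e5

end KNet

/-! ### Integrals over the sides of rectangles -/

section Lines

theorem hasDerivAt_du {E : Type*} [NormedAddCommGroup E] [NormedSpace ℝ E] {F : ℝ × ℝ → E}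
    {u v : ℝ} (h : DifferentiableAt ℝ F (u, v)) :
    HasDerivAt (fun x => F (x, v)) (du F (u, v)) u :=
  h.hasFDerivAt.comp_hasDerivAt u ((hasDerivAt_id u).prodMk (hasDerivAt_const u v))

theorem hasDerivAt_dv {E : Type*} [NormedAddCommGroup E] [NormedSpace ℝ E] {F : ℝ × ℝ → E}
    {u v : ℝ} (h : DifferentiableAt ℝ F (u, v)) :
    HasDerivAt (fun y => F (u, y)) (dv F (u, v)) v :=
  h.hasFDerivAt.comp_hasDerivAt v ((hasDerivAt_const v u).prodMk (hasDerivAt_id v))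

variable {I J : Set ℝ}

theorem continuousOn_uLine {F : ℝ × ℝ → ℝ} (hF : ContinuousOn F (I ×ˢ J)) {v : ℝ} (hv : v ∈ J) :
    ContinuousOn (fun u => F (u, v)) I :=
  hF.comp (by fun_prop) fun _ hu => ⟨hu, hv⟩

theorem continuousOn_vLine {F : ℝ × ℝ → ℝ} (hF : ContinuousOn F (I ×ˢ J)) {u : ℝ} (hu : u ∈ I) :
    ContinuousOn (fun v => F (u, v)) J :=
  hF.comp (by fun_prop) fun _ hv => ⟨hu, hv⟩

theorem intervalIntegrable_of_mem {f : ℝ → ℝ} (hI : IsOpenInterval I) (hf : ContinuousOn f I)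
    {a b : ℝ} (ha : a ∈ I) (hb : b ∈ I) : IntervalIntegrable f MeasureTheory.volume a b :=
  (hf.mono (hI.2.2.uIcc_subset ha hb)).intervalIntegrable

/-- On a small rectangle with `f_v > m₁ > m₂ > g_u` the two sides of the loop identity are
separated by `m₁` and `m₂` times its area. -/
theorem dv_le_du_of_loops (hI : IsOpenInterval I) (hJ : IsOpenInterval J) {f g : ℝ × ℝ → ℝ}
    (hf : ContDiffOn ℝ ∞ f (I ×ˢ J)) (hg : ContDiffOn ℝ ∞ g (I ×ˢ J))
    (h : ∀ u₀ ∈ I, ∀ u₁ ∈ I, ∀ v₀ ∈ J, ∀ v₁ ∈ J, u₀ ≤ u₁ → v₀ ≤ v₁ →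
      (∫ u in u₀..u₁, f (u, v₀)) + ∫ v in v₀..v₁, g (u₁, v) =
        (∫ v in v₀..v₁, g (u₀, v)) + ∫ u in u₀..u₁, f (u, v₁))
    {p : ℝ × ℝ} (hp : p ∈ I ×ˢ J) : dv f p ≤ du g p := by
  by_contra! hlt
  have hs := hI.isOpen_prod hJ
  obtain ⟨m₂, hm₂, hm₂'⟩ := exists_between hlt
  obtain ⟨m₁, hm₁, hm₁'⟩ := exists_between hm₂'
  have hfv := (contDiffOn_dv hs hf).continuousOn.continuousAt (hs.mem_nhds hp)
  have hgu := (contDiffOn_du hs hg).continuousOn.continuousAt (hs.mem_nhds hp)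
  have hev : ∀ᶠ q in nhds p, q ∈ I ×ˢ J ∧ m₁ < dv f q ∧ du g q < m₂ :=
    (hs.eventually_mem hp).and ((hfv.eventually_const_lt hm₁').and (hgu.eventually_lt_const hm₂))
  obtain ⟨r, hr, hball⟩ := Metric.eventually_nhds_iff_ball.1 hev
  obtain ⟨u, v⟩ := p
  have hbox : ∀ x ∈ Set.Icc u (u + r / 2), ∀ y ∈ Set.Icc v (v + r / 2),
      (x, y) ∈ I ×ˢ J ∧ m₁ < dv f (x, y) ∧ du g (x, y) < m₂ := by
    intro x hx y hy
    apply hball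
    rw [Metric.mem_ball, Prod.dist_eq, max_lt_iff, Real.dist_eq, Real.dist_eq,
      abs_of_nonneg (by linarith [hx.1]), abs_of_nonneg (by linarith [hy.1])]
    exact ⟨by linarith [hx.2], by linarith [hy.2]⟩
  set d := r / 2 with hd
  have hd0 : 0 < d := by positivity
  have hu0 : u ∈ Set.Icc u (u + d) := ⟨le_rfl, by linarith⟩
  have hu1 : u + d ∈ Set.Icc u (u + d) := ⟨by linarith, le_rfl⟩
  have hv0 : v ∈ Set.Icc v (v + d) := ⟨le_rfl, by linarith⟩
  have hv1 : v + d ∈ Set.Icc v (v + d) := ⟨by linarith, le_rfl⟩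
  have hIu := (hbox _ hu0 _ hv0).1.1
  have hJv := (hbox _ hu0 _ hv0).1.2
  have hIu1 := (hbox _ hu1 _ hv0).1.1
  have hJv1 := (hbox _ hu0 _ hv1).1.2
  have key := h u hIu (u + d) hIu1 v hJv (v + d) hJv1 (by linarith) (by linarith)
  have if0 := intervalIntegrable_of_mem hI (continuousOn_uLine hf.continuousOn hJv) hIu hIu1
  have if1 := intervalIntegrable_of_mem hI (continuousOn_uLine hf.continuousOn hJv1) hIu hIu1
  have ig0 := intervalIntegrable_of_mem hJ (continuousOn_vLine hg.continuousOn hIu) hJv hJv1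
  have ig1 := intervalIntegrable_of_mem hJ (continuousOn_vLine hg.continuousOn hIu1) hJv hJv1
  have h1 : (∫ _ in u..(u + d), m₁ * d) ≤ ∫ x in u..(u + d), (f (x, v + d) - f (x, v)) := by
    refine intervalIntegral.integral_mono_on (by linarith) (by simp) (if1.sub if0) fun x hx => ?_
    have hder : ∀ y ∈ Set.Icc v (v + d), HasDerivAt (fun y => f (x, y)) (dv f (x, y)) y :=
      fun y hy => hasDerivAt_dv (diffAt hs hf (hbox x hx y hy).1)
    have := (convex_Icc v (v + d)).mul_sub_le_image_sub_of_le_deriv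
      (fun y hy => (hder y hy).continuousAt.continuousWithinAt)
      (fun y hy => (hder y (interior_subset hy)).differentiableAt.differentiableWithinAt)
      (C := m₁)
      (fun y hy => by
        rw [(hder y (interior_subset hy)).deriv]
        exact (hbox x hx y (interior_subset hy)).2.1.le) v hv0 (v + d) hv1 (by linarith)
    simpa using this
  have h2 : (∫ y in v..(v + d), (g (u + d, y) - g (u, y))) ≤ ∫ _ in v..(v + d), m₂ * d := by
    refine intervalIntegral.integral_mono_on (by linarith) (ig1.sub ig0) (by simp) fun y hy => ?_
    have hder : ∀ x ∈ Set.Icc u (u + d), HasDerivAt (fun x => g (x, y)) (du g (x, y)) x :=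
      fun x hx => hasDerivAt_du (diffAt hs hg (hbox x hx y hy).1)
    have := (convex_Icc u (u + d)).image_sub_le_mul_sub_of_deriv_le
      (fun x hx => (hder x hx).continuousAt.continuousWithinAt)
      (fun x hx => (hder x (interior_subset hx)).differentiableAt.differentiableWithinAt)
      (C := m₂)
      (fun x hx => by
        rw [(hder x (interior_subset hx)).deriv]
        exact (hbox x (interior_subset hx) y hy).2.2.le) u hu0 (u + d) hu1 (by linarith)
    simpa using this
  rw [intervalIntegral.integral_sub if1 if0, intervalIntegral.integral_const] at h1
  rw [intervalIntegral.integral_sub ig1 ig0, intervalIntegral.integral_const] at h2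
  simp only [add_sub_cancel_left, smul_eq_mul] at h1 h2
  have : d * (m₁ * d) ≤ d * (m₂ * d) := by linarith
  have h3 : 0 < d * d := by positivity
  nlinarith

/-- A one-form `f du + g dv` whose integrals along the two paths joining opposite corners of
every rectangle agree is closed. -/
theorem dv_eq_du_of_loops (hI : IsOpenInterval I) (hJ : IsOpenInterval J) {f g : ℝ × ℝ → ℝ}
    (hf : ContDiffOn ℝ ∞ f (I ×ˢ J)) (hg : ContDiffOn ℝ ∞ g (I ×ˢ J))
    (h : ∀ u₀ ∈ I, ∀ u₁ ∈ I, ∀ v₀ ∈ J, ∀ v₁ ∈ J, u₀ ≤ u₁ → v₀ ≤ v₁ →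
      (∫ u in u₀..u₁, f (u, v₀)) + ∫ v in v₀..v₁, g (u₁, v) =
        (∫ v in v₀..v₁, g (u₀, v)) + ∫ u in u₀..u₁, f (u, v₁))
    {p : ℝ × ℝ} (hp : p ∈ I ×ˢ J) : dv f p = du g p := by
  refine le_antisymm (dv_le_du_of_loops hI hJ hf hg h hp) ?_
  have := dv_le_du_of_loops hI hJ hf.neg hg.neg (fun u₀ h0 u₁ h1 v₀ h2 v₁ h3 h4 h5 => by
    simp only [intervalIntegral.integral_neg]
    linarith [h u₀ h0 u₁ h1 v₀ h2 v₁ h3 h4 h5]) hp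
  rw [dv_neg, du_neg] at this
  linarith

end Lines

/-! ### Uniqueness for the Goursat problem -/

/-- Integrating an exponential bound with rate `l` gains a factor `1 / l`. -/
theorem abs_le_exp_of_deriv_le {f f' : ℝ → ℝ} {M l a : ℝ} (hl : 0 < l) (hM : 0 ≤ M)
    (h0 : f 0 = 0) (hf : ∀ t ∈ Set.Icc (0 : ℝ) 1, HasDerivAt f (f' t) t)
    (hb : ∀ t ∈ Set.Icc (0 : ℝ) 1, |f' t| ≤ M * Real.exp (l * (a + t))) :
    ∀ t ∈ Set.Icc (0 : ℝ) 1, |f t| ≤ M / l * Real.exp (l * (a + t)) := by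
  have hB : ∀ t, HasDerivAt (fun t => M / l * Real.exp (l * (a + t)))
      (M * Real.exp (l * (a + t))) t := by
    intro t
    have := (((hasDerivAt_id t).const_add a).const_mul l).exp.const_mul (M / l)
    refine this.congr_deriv ?_
    simp only [id_eq, mul_one]
    field_simp
  exact fun t ht => image_norm_le_of_norm_deriv_right_le_deriv_boundary
    (fun t ht => (hf t ht).continuousAt.continuousWithinAt)
    (fun t ht => (hf t (Set.Ico_subset_Icc_self ht)).hasDerivWithinAt)
    (by rw [h0, norm_zero]; positivity) hB
    (fun t ht => hb t (Set.Ico_subset_Icc_self ht)) ht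

/-- A solution of `|D_uv| ≤ K |D|` that vanishes on two crossing coordinate lines vanishes. -/
theorem goursat_unique {I J : Set ℝ} (hI : IsOpenInterval I) (hJ : IsOpenInterval J)
    {D : ℝ × ℝ → ℝ} (hD : ContDiffOn ℝ ∞ D (I ×ˢ J)) {K : ℝ}
    (hK : ∀ q ∈ I ×ˢ J, |dv (du D) q| ≤ K * |D q|) {u₀ v₀ : ℝ} (hu₀ : u₀ ∈ I) (hv₀ : v₀ ∈ J)
    (h1 : ∀ u ∈ I, D (u, v₀) = 0) (h2 : ∀ v ∈ J, D (u₀, v) = 0) :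
    ∀ q ∈ I ×ˢ J, D q = 0 := by
  rintro ⟨u₁, v₁⟩ ⟨hu₁, hv₁⟩
  have hs := hI.isOpen_prod hJ
  have hDu := contDiffOn_du hs hD
  set α := u₁ - u₀ with hα
  set β := v₁ - v₀ with hβ
  have hx : ∀ x ∈ Set.Icc (0 : ℝ) 1, u₀ + α * x ∈ I := fun x hx => by
    have := hI.2.2.convex.add_smul_sub_mem hu₀ hu₁ hx
    rwa [smul_eq_mul, mul_comm] at this
  have hy : ∀ y ∈ Set.Icc (0 : ℝ) 1, v₀ + β * y ∈ J := fun y hy => by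
    have := hJ.2.2.convex.add_smul_sub_mem hv₀ hv₁ hy
    rwa [smul_eq_mul, mul_comm] at this
  have hK0 : 0 ≤ |K| := abs_nonneg K
  -- The weight `exp (-l (x + y))` is chosen so that integrating twice halves the weighted norm.
  set L := |α| * |β| * |K| with hL
  have hL0 : 0 ≤ L := by positivity
  set l := L + 2 with hl
  have hl0 : 0 < l := by positivity
  have hcont : ContinuousOn
      (fun z : ℝ × ℝ => |D (u₀ + α * z.1, v₀ + β * z.2)| * Real.exp (-(l * (z.1 + z.2))))
      (Set.Icc 0 1 ×ˢ Set.Icc 0 1) := by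
    refine ContinuousOn.mul (ContinuousOn.abs ?_) (by fun_prop)
    exact hD.continuousOn.comp (f := fun z : ℝ × ℝ => (u₀ + α * z.1, v₀ + β * z.2))
      (by fun_prop) fun z hz => ⟨hx _ hz.1, hy _ hz.2⟩
  obtain ⟨⟨x', y'⟩, hz, hmax⟩ := (isCompact_Icc.prod isCompact_Icc).exists_isMaxOn
    ⟨((0 : ℝ), (0 : ℝ)), by simp⟩ hcont
  set m := |D (u₀ + α * x', v₀ + β * y')| * Real.exp (-(l * (x' + y'))) with hm
  have hm0 : 0 ≤ m := by positivity
  have hDm : ∀ x ∈ Set.Icc (0 : ℝ) 1, ∀ y ∈ Set.Icc (0 : ℝ) 1,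
      |D (u₀ + α * x, v₀ + β * y)| ≤ m * Real.exp (l * (x + y)) := by
    intro x hx y hy
    have : |D (u₀ + α * x, v₀ + β * y)| * Real.exp (-(l * (x + y))) ≤ m :=
      hmax (a := (x, y)) ⟨hx, hy⟩
    rwa [Real.exp_neg, ← div_eq_mul_inv, div_le_iff₀ (Real.exp_pos _)] at this
  have hDum : ∀ x ∈ Set.Icc (0 : ℝ) 1, ∀ y ∈ Set.Icc (0 : ℝ) 1,
      |du D (u₀ + α * x, v₀ + β * y)| ≤ |β| * |K| * m / l * Real.exp (l * (x + y)) := by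
    intro x hx'
    have hline : ∀ y ∈ Set.Icc (0 : ℝ) 1,
        HasDerivAt (fun y => du D (u₀ + α * x, v₀ + β * y))
          (dv (du D) (u₀ + α * x, v₀ + β * y) * β) y := fun y hy' => by
      have := (hasDerivAt_dv (diffAt hs hDu (Set.mk_mem_prod (hx x hx') (hy y hy')))).comp y
        (((hasDerivAt_id y).const_mul β).const_add v₀)
      simpa [Function.comp_def] using this
    refine abs_le_exp_of_deriv_le hl0 (by positivity) ?_ hline fun y hy' => ?_
    · have e := (hasDerivAt_du (diffAt hs hD (Set.mk_mem_prod (hx x hx') hv₀))).unique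
        ((hasDerivAt_const (u₀ + α * x) (0 : ℝ)).congr_of_eventuallyEq
          (Filter.eventuallyEq_of_mem (hI.2.1.mem_nhds (hx x hx')) h1))
      simpa using e
    · rw [abs_mul]
      have e1 := hK _ (Set.mk_mem_prod (hx x hx') (hy y hy'))
      have e2 := hDm x hx' y hy'
      have e3 : K * |D (u₀ + α * x, v₀ + β * y)| ≤ |K| * (m * Real.exp (l * (x + y))) :=
        mul_le_mul (le_abs_self K) e2 (abs_nonneg _) hK0
      calc _ ≤ (|K| * (m * Real.exp (l * (x + y)))) * |β| :=
            mul_le_mul_of_nonneg_right (e1.trans e3) (abs_nonneg β)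
        _ = _ := by ring
  have hDm' : |D (u₀ + α * x', v₀ + β * y')| ≤
      |α| * (|β| * |K| * m / l) / l * Real.exp (l * (y' + x')) := by
    refine abs_le_exp_of_deriv_le (f := fun x => D (u₀ + α * x, v₀ + β * y'))
      (f' := fun x => du D (u₀ + α * x, v₀ + β * y') * α) hl0 (by positivity) ?_
      (fun x hx' => ?_) (fun x hx' => ?_) x' hz.1
    · simpa using h2 _ (hy y' hz.2)
    · have := (hasDerivAt_du (diffAt hs hD (Set.mk_mem_prod (hx x hx') (hy y' hz.2)))).comp x
        (((hasDerivAt_id x).const_mul α).const_add u₀)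
      simpa [Function.comp_def] using this
    · rw [abs_mul, add_comm y' x, mul_comm]
      calc _ ≤ |α| * (|β| * |K| * m / l * Real.exp (l * (x + y'))) :=
            mul_le_mul_of_nonneg_left (hDum x hx' y' hz.2) (abs_nonneg α)
        _ = _ := by ring
  have hmle : m ≤ L / l ^ 2 * m := by
    have : |D (u₀ + α * x', v₀ + β * y')| ≤ (L / l ^ 2 * m) * Real.exp (l * (x' + y')) := by
      rw [add_comm y' x'] at hDm'
      refine hDm'.trans_eq ?_
      field_simp
      rw [hL]; ring
    calc m = |D (u₀ + α * x', v₀ + β * y')| / Real.exp (l * (x' + y')) := by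
          rw [hm, Real.exp_neg, ← div_eq_mul_inv]
      _ ≤ L / l ^ 2 * m := (div_le_iff₀ (Real.exp_pos _)).2 this
  have hlt : L / l ^ 2 ≤ 1 / 2 := by
    rw [div_le_iff₀ (by positivity)]; nlinarith
  have hmz : m = 0 := le_antisymm (by nlinarith) hm0
  have := hDm 1 ⟨zero_le_one, le_rfl⟩ 1 ⟨zero_le_one, le_rfl⟩
  rw [hmz, zero_mul, mul_one, mul_one, hα, hβ, add_sub_cancel, add_sub_cancel] at this
  exact abs_nonpos_iff.1 this

/-! ### Angle fields -/

section AngleField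

variable {ψ : ℝ × ℝ → Space} {s : Set (ℝ × ℝ)}

/-- For `F = A ω_u - B ω_v` with `A = A(u)`, `B = B(v)` and `ω` a solution of the sine-Gordon
equation, `F_uv = (A' - B') sin ω + cos ω F`. -/
theorem IsKNet.dv_du_angle_deriv (hs : IsOpen s) (hc : IsPreconnected s) (h : IsKNet ψ s)
    {A B : ℝ × ℝ → ℝ} (hA : ContDiffOn ℝ ∞ A s) (hB : ContDiffOn ℝ ∞ B s)
    (hAv : ∀ q ∈ s, dv A q = 0) (hBu : ∀ q ∈ s, du B q = 0) {p : ℝ × ℝ} (hp : p ∈ s) :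
    dv (du fun q => A q * du (netAngle ψ) q - B q * dv (netAngle ψ) q) p =
      (du A p - dv B p) * Real.sin (netAngle ψ p) +
        Real.cos (netAngle ψ p) * (A p * du (netAngle ψ) p - B p * dv (netAngle ψ) p) := by
  have hω := h.contDiffOn_netAngle hs
  have hωu := contDiffOn_du hs hω
  have hωv := contDiffOn_dv hs hω
  have hSG : ∀ q ∈ s, dv (du (netAngle ψ)) q = Real.sin (netAngle ψ q) :=
    fun q hq => h.sine_gordon hs hc hq
  have e1 : ∀ q ∈ s, du (fun q => A q * du (netAngle ψ) q - B q * dv (netAngle ψ) q) q =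
      du A q * du (netAngle ψ) q + A q * du (du (netAngle ψ)) q
        - B q * Real.sin (netAngle ψ q) := by
    intro q hq
    rw [du_sub (diffAt hs (hA.mul hωu) hq) (diffAt hs (hB.mul hωv) hq),
      du_mul (diffAt hs hA hq) (diffAt hs hωu hq), du_mul (diffAt hs hB hq) (diffAt hs hωv hq),
      hBu q hq, ← dv_du_eq hs hω hq, hSG q hq]
    ring
  have hAu := contDiffOn_du hs hA
  have hωuu := contDiffOn_du hs hωu
  have e2 : dv (du A) p = 0 := by
    rw [dv_du_eq hs hA hp, du_congr hs hAv hp, du_const]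
  have e3 : dv (du (du (netAngle ψ))) p = Real.cos (netAngle ψ p) * du (netAngle ψ) p := by
    rw [dv_du_eq hs hωu hp, du_congr hs hSG hp, du_sin (diffAt hs hω hp)]
  rw [dv_congr hs e1 hp,
    dv_sub (diffAt hs ((hAu.mul hωu).add (hA.mul hωuu)) hp) (diffAt hs (hB.mul hω.sin) hp),
    dv_add (diffAt hs (hAu.mul hωu) hp) (diffAt hs (hA.mul hωuu) hp),
    dv_mul (diffAt hs hAu hp) (diffAt hs hωu hp), dv_mul (diffAt hs hA hp) (diffAt hs hωuu hp),
    dv_mul (diffAt hs hB hp) (diffAt hs hω.sin hp), dv_sin (diffAt hs hω hp), hSG p hp, e2, e3,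
    hAv p hp]
  ring

/-- Since `ω_uv = sin ω` has no zeros, a smooth factor that kills `ω_v` vanishes: differentiating
`f ω_v = 0` along `u` and multiplying by `f` yields `f² sin ω = 0`. -/
theorem IsKNet.eq_zero_of_mul_dv (hs : IsOpen s) (hc : IsPreconnected s) (h : IsKNet ψ s)
    {f : ℝ × ℝ → ℝ} (hf : ContDiffOn ℝ ∞ f s) (h0 : ∀ q ∈ s, f q * dv (netAngle ψ) q = 0) :
    ∀ q ∈ s, f q = 0 := by
  intro q hq
  have hω := h.contDiffOn_netAngle hs
  have e := du_congr hs h0 hq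
  rw [du_mul (diffAt hs hf hq) (diffAt hs (contDiffOn_dv hs hω) hq), du_const,
    ← dv_du_eq hs hω hq, h.sine_gordon hs hc hq] at e
  have : f q ^ 2 * Real.sin (netAngle ψ q) = 0 := by
    linear_combination f q * e - du f q * h0 q hq
  simpa [(h.sin_pos hq).ne'] using this

variable {U V : ℝ × ℝ → ℝ}

theorem IsAngleField.mul_du_eq (hUV : IsAngleField ψ s U V) {p : ℝ × ℝ} (hp : p ∈ s) :
    U p * du (netAngle ψ) p = V p * dv (netAngle ψ) p := by
  have := (hUV.2.2 p hp).2.2.2.2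
  rw [fderiv_apply_eq] at this
  simp only [smul_eq_mul] at this
  linarith

/-- The derivatives of `U(u)` and `V(v)` agree, so both are constant. -/
theorem IsAngleField.exists_const_deriv (hs : IsOpen s) (hc : IsPreconnected s) (h : IsKNet ψ s)
    (hUV : IsAngleField ψ s U V) : ∃ k : ℝ, ∀ q ∈ s, du U q = k ∧ dv V q = k := by
  obtain ⟨hU, hV, h0⟩ := id hUV
  have hUv : ∀ q ∈ s, dv U q = 0 := fun q hq => (h0 q hq).2.2.1
  have hVu : ∀ q ∈ s, du V q = 0 := fun q hq => (h0 q hq).2.2.2.1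
  have heq : ∀ q ∈ s, du U q = dv V q := by
    intro q hq
    have hF : ∀ q ∈ s, U q * du (netAngle ψ) q - V q * dv (netAngle ψ) q = 0 :=
      fun q hq => sub_eq_zero.2 (hUV.mul_du_eq hq)
    have e := h.dv_du_angle_deriv hs hc hU hV hUv hVu hq
    rw [hF q hq, dv_congr hs (fun q hq => (du_congr hs hF hq).trans (du_const _)) hq,
      dv_const] at e
    have : (du U q - dv V q) * Real.sin (netAngle ψ q) = 0 := by linarith
    simpa [(h.sin_pos hq).ne', sub_eq_zero] using this
  obtain ⟨k, hk⟩ := exists_const_of_partials_eq_zero hs hc (contDiffOn_du hs hU)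
    (fun q hq => by
      rw [du_congr hs heq hq, ← dv_du_eq hs hV hq, dv_congr hs hVu hq, dv_const])
    (fun q hq => by rw [dv_du_eq hs hU hq, du_congr hs hUv hq, du_const])
  exact ⟨k, fun q hq => ⟨hk q hq, (heq q hq).symm.trans (hk q hq)⟩⟩

/-- Two fields with `dω = 0` on them and coefficients depending on one variable each are
proportional. -/
theorem IsAngleField.exists_const_mul (hs : IsOpen s) (hc : IsPreconnected s) (h : IsKNet ψ s)
    (hUV : IsAngleField ψ s U V) {f g : ℝ × ℝ → ℝ} (hf : ContDiffOn ℝ ∞ f s)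
    (hg : ContDiffOn ℝ ∞ g s) (hfv : ∀ q ∈ s, dv f q = 0) (hgu : ∀ q ∈ s, du g q = 0)
    (hfg : ∀ q ∈ s, g q * du (netAngle ψ) q = f q * dv (netAngle ψ) q) :
    ∃ C : ℝ, ∀ q ∈ s, f q * U q = C ∧ g q * V q = C := by
  obtain ⟨hU, hV, h0⟩ := id hUV
  have heq : ∀ q ∈ s, f q * U q = g q * V q := by
    intro q hq
    refine sub_eq_zero.1 (h.eq_zero_of_mul_dv hs hc ((hf.mul hU).sub (hg.mul hV)) ?_ q hq)
    intro q hq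
    change (f q * U q - g q * V q) * _ = 0
    linear_combination g q * hUV.mul_du_eq hq - U q * hfg q hq
  obtain ⟨C, hC⟩ := exists_const_of_partials_eq_zero hs hc (hf.mul hU)
    (fun q hq => by
      rw [du_congr hs heq hq, du_mul (diffAt hs hg hq) (diffAt hs hV hq), hgu q hq,
        (h0 q hq).2.2.2.1]
      ring)
    (fun q hq => by
      change dv (fun q => f q * U q) q = 0
      rw [dv_mul (diffAt hs hf hq) (diffAt hs hU hq), hfv q hq, (h0 q hq).2.2.1]
      ring)
  exact ⟨C, fun q hq => ⟨hC q hq, (heq q hq).symm.trans (hC q hq)⟩⟩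

/-- The reciprocals of nowhere vanishing `f(u)`, `g(v)` with `g ω_u = f ω_v`. -/
theorem isAngleField_inv (hs : IsOpen s) {f g : ℝ × ℝ → ℝ} (hf : ContDiffOn ℝ ∞ f s)
    (hg : ContDiffOn ℝ ∞ g s) (hf0 : ∀ q ∈ s, f q ≠ 0) (hg0 : ∀ q ∈ s, g q ≠ 0)
    (hfv : ∀ q ∈ s, dv f q = 0) (hgu : ∀ q ∈ s, du g q = 0)
    (hfg : ∀ q ∈ s, g q * du (netAngle ψ) q = f q * dv (netAngle ψ) q) :
    IsAngleField ψ s (fun q => (f q)⁻¹) (fun q => (g q)⁻¹) := by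
  have hfi : ContDiffOn ℝ ∞ (fun q => (f q)⁻¹) s := hf.inv hf0
  have hgi : ContDiffOn ℝ ∞ (fun q => (g q)⁻¹) s := hg.inv hg0
  refine ⟨hfi, hgi, fun q hq => ⟨inv_ne_zero (hf0 q hq), inv_ne_zero (hg0 q hq), ?_, ?_, ?_⟩⟩
  · have e := dv_congr hs (fun q hq => mul_inv_cancel₀ (hf0 q hq)) hq
    rw [dv_mul (diffAt hs hf hq) (diffAt hs hfi hq), hfv q hq, dv_const] at e
    simpa [hf0 q hq] using e
  · have e := du_congr hs (fun q hq => mul_inv_cancel₀ (hg0 q hq)) hq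
    rw [du_mul (diffAt hs hg hq) (diffAt hs hgi hq), hgu q hq, du_const] at e
    simpa [hg0 q hq] using e
  · rw [fderiv_apply_eq]
    have := hf0 q hq
    have := hg0 q hq
    simp only [smul_eq_mul]
    field_simp
    linarith [hfg q hq]

end AngleField

/-! ### Rotation fields -/

section Rotation

variable {ψ η : ℝ × ℝ → Space} {s : Set (ℝ × ℝ)} {p : ℝ × ℝ}

/-- Integrability of `dξ = η × dψ`. -/
theorem IsRotationField.cross_eq (hs : IsOpen s) (h : IsKNet ψ s) (hη : IsRotationField ψ η s)
    (hp : p ∈ s) : cross (dv η p) (du ψ p) = cross (du η p) (dv ψ p) := by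
  obtain ⟨hηnet, ξ, hξ, hrot⟩ := hη
  have dη := diffAt hs hηnet.1 hp
  have e := dv_du_eq hs hξ.1 hp
  have r1 : ∀ q ∈ s, du ξ q = cross (η q) (du ψ q) := fun q hq => hrot q hq (1, 0)
  have r2 : ∀ q ∈ s, dv ξ q = cross (η q) (dv ψ q) := fun q hq => hrot q hq (0, 1)
  rw [dv_congr hs r1 hp, du_congr hs r2 hp, dv_cross dη (h.diffAt_du hs hp),
    du_cross dη (h.diffAt_dv hs hp),
    dv_du_eq hs h.smooth hp] at e
  exact add_right_cancel e

/-- `dη` is tangent to `ψ`. -/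
theorem IsRotationField.inner_normal (hs : IsOpen s) (h : IsKNet ψ s)
    (hη : IsRotationField ψ η s) (hp : p ∈ s) :
    ⟪du η p, cross (du ψ p) (dv ψ p)⟫ = 0 ∧ ⟪dv η p, cross (du ψ p) (dv ψ p)⟫ = 0 := by
  have e := hη.cross_eq hs h hp
  constructor
  · have := congrArg (fun z => ⟪du ψ p, z⟫) e
    simp only [inner_cross_right] at this
    rw [inner_cross_rotate, inner_cross_rotate, inner_cross_swap] at this
    linarith
  · have := congrArg (fun z => ⟪dv ψ p, z⟫) e
    simp only [inner_cross_right] at this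
    rw [inner_cross_rotate, inner_cross_rotate] at this
    linarith

/-- The vectors `ψ_uu × ψ_v` and `ψ_u × ψ_vv` are normal to the surface, because the coordinate
lines are asymptotic. -/
theorem IsKNet.inner_cross_second (hs : IsOpen s) (h : IsKNet ψ s) (hp : p ∈ s) {z : Space}
    (hz : ⟪z, cross (du ψ p) (dv ψ p)⟫ = 0) :
    ⟪z, cross (du (du ψ) p) (dv ψ p)⟫ = 0 ∧ ⟪z, cross (du ψ p) (dv (dv ψ) p)⟫ = 0 := by
  obtain ⟨g1, g2⟩ := h.gauss_formulas hs hp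
  have hs0 := (h.sin_pos hp).ne'
  constructor <;> apply mul_left_cancel₀ hs0
  · have e : Real.sin (netAngle ψ p) * ⟪z, cross (du (du ψ) p) (dv ψ p)⟫ =
        ⟪z, crossL (Real.sin (netAngle ψ p) • du (du ψ) p) (dv ψ p)⟫ := by
      rw [map_smul, smul_apply, inner_smul_right, crossL_apply]
    have e0 : cross (dv ψ p) (dv ψ p) = 0 := by
      apply space_ext <;> simp [cross_coord] <;> ring
    rw [e, g1]
    simp only [map_smul, map_sub, smul_apply, sub_apply,
      inner_smul_right, inner_sub_right, crossL_apply, hz, e0, inner_zero_right]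
    ring
  · have e : Real.sin (netAngle ψ p) * ⟪z, cross (du ψ p) (dv (dv ψ) p)⟫ =
        ⟪z, crossL (du ψ p) (Real.sin (netAngle ψ p) • dv (dv ψ) p)⟫ := by
      rw [map_smul, inner_smul_right, crossL_apply]
    have e0 : cross (du ψ p) (du ψ p) = 0 := by
      apply space_ext <;> simp [cross_coord] <;> ring
    rw [e, g2]
    simp only [map_smul, map_sub, inner_smul_right, inner_sub_right, crossL_apply, hz, e0,
      inner_zero_right]
    ring

theorem cross_cross_left (x y : Space) : cross (cross x y) y = ⟪x, y⟫ • y - ⟪y, y⟫ • x := by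
  apply space_ext <;>
  simp only [inner_eq_coord, cross_coord, PiLp.sub_apply, PiLp.smul_apply, smul_eq_mul] <;> ring

theorem cross_cross_right (x y : Space) : cross x (cross x y) = ⟪x, y⟫ • x - ⟪x, x⟫ • y := by
  apply space_ext <;>
  simp only [inner_eq_coord, cross_coord, PiLp.sub_apply, PiLp.smul_apply, smul_eq_mul] <;> ring

/-- The rotation operator is trace free by integrability of `dη × dψ`, and its diagonal entries
agree by the symmetry of the normal component of `η_uv`; so it is off-diagonal. -/
theorem IsRotationField.partials_eq_inner (hs : IsOpen s) (hc : IsPreconnected s)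
    (h : IsKNet ψ s) (hη : IsRotationField ψ η s) (hp : p ∈ s) :
    du η p = ⟪du η p, dv ψ p⟫ • dv ψ p ∧ dv η p = ⟪dv η p, du ψ p⟫ • du ψ p := by
  obtain ⟨ε, hε, hsign⟩ := h.exists_sign hs hc
  have hP := contDiffOn_du hs h.smooth
  have hQ := contDiffOn_dv hs h.smooth
  have hn := contDiffOn_cross hP hQ
  have hR := contDiffOn_du hs hη.1.1
  have hS := contDiffOn_dv hs hη.1.1
  obtain ⟨n1, n2⟩ := hη.inner_normal hs h hp
  have hQP : ⟪dv ψ p, du ψ p⟫ = Real.cos (netAngle ψ p) := by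
    rw [real_inner_comm, h.inner_du_dv hp]
  have e1 := congrArg (fun z => ⟪cross (du ψ p) (dv ψ p), z⟫) (hη.cross_eq hs h hp)
  simp only [inner_cross_cross, h.inner_du_du hp, h.inner_dv_dv hp, h.inner_du_dv hp, hQP] at e1
  rw [real_inner_comm (dv η p) (du ψ p), real_inner_comm (dv η p) (dv ψ p),
    real_inner_comm (du η p) (du ψ p), real_inner_comm (du η p) (dv ψ p)] at e1
  have f1 := dv_congr hs (fun q hq => (hη.inner_normal hs h hq).1) hp
  have f2 := du_congr hs (fun q hq => (hη.inner_normal hs h hq).2) hp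
  rw [dv_inner (diffAt hs hR hp) (diffAt hs hn hp), dv_const, dv_du_eq hs hη.1.1 hp,
    dv_cross (diffAt hs hP hp) (diffAt hs hQ hp), inner_add_right,
    (h.inner_cross_second hs hp n1).2, dv_du_eq hs h.smooth hp, hsign p hp, cross_smul_left,
    cross_cross_left, inner_smul_right, inner_sub_right, inner_smul_right, inner_smul_right,
    h.inner_dv_dv hp, h.inner_du_dv hp] at f1
  rw [du_inner (diffAt hs hS hp) (diffAt hs hn hp), du_const,
    du_cross (diffAt hs hP hp) (diffAt hs hQ hp), inner_add_right,
    (h.inner_cross_second hs hp n2).1, hsign p hp, ← crossL_apply (du ψ p) (ε • _), map_smul,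
    crossL_apply, cross_cross_right, inner_smul_right, inner_sub_right, inner_smul_right,
    inner_smul_right, h.inner_du_du hp, h.inner_du_dv hp] at f2
  have g : ε * (Real.cos (netAngle ψ p) * ⟪dv η p, du ψ p⟫ - ⟪dv η p, dv ψ p⟫) = 0 := by
    linear_combination (f2 - f1) / 2 + ε / 2 * e1
  have hε0 : ε ≠ 0 := by rintro rfl; norm_num at hε
  have g1 : Real.cos (netAngle ψ p) * ⟪dv η p, du ψ p⟫ - ⟪dv η p, dv ψ p⟫ = 0 := by
    simpa [hε0] using g
  constructor <;> apply h.ext_inner hp <;>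
    simp only [inner_smul_left, conj_trivial, h.inner_du_du hp, h.inner_dv_dv hp,
      h.inner_du_dv hp, hQP, inner_cross_left, inner_cross_right, n1, n2] <;> linarith

theorem IsRotationField.coeff_eq (hs : IsOpen s) (hc : IsPreconnected s)
    (h : IsKNet ψ s) (hη : IsRotationField ψ η s) (hp : p ∈ s) :
    coeffC ψ η p = ⟪du η p, dv ψ p⟫ ∧ coeffB ψ η p = ⟪dv η p, du ψ p⟫ := by
  obtain ⟨e1, e2⟩ := hη.partials_eq_inner hs hc h hp
  have hinv := Function.leftInverse_invFun (h.1.2 p hp)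
  constructor
  · have : fderiv ℝ η p (1, 0) = fderiv ℝ ψ p (0, ⟪du η p, dv ψ p⟫) := by
      rw [fderiv_apply_eq ψ]; simpa using! e1
    rw [coeffC, rotationOperator, this, hinv]
  · have : fderiv ℝ η p (0, 1) = fderiv ℝ ψ p (⟪dv η p, du ψ p⟫, 0) := by
      rw [fderiv_apply_eq ψ]; simpa using! e2
    rw [coeffB, rotationOperator, this, hinv]

theorem IsRotationField.partials_eq (hs : IsOpen s) (hc : IsPreconnected s)
    (h : IsKNet ψ s) (hη : IsRotationField ψ η s) (hp : p ∈ s) :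
    du η p = coeffC ψ η p • dv ψ p ∧ dv η p = coeffB ψ η p • du ψ p := by
  rw [(hη.coeff_eq hs hc h hp).1, (hη.coeff_eq hs hc h hp).2]
  exact hη.partials_eq_inner hs hc h hp

theorem IsRotationField.contDiffOn_coeff (hs : IsOpen s) (hc : IsPreconnected s)
    (h : IsKNet ψ s) (hη : IsRotationField ψ η s) :
    ContDiffOn ℝ ∞ (coeffB ψ η) s ∧ ContDiffOn ℝ ∞ (coeffC ψ η) s :=
  ⟨(ContDiffOn.inner ℝ (contDiffOn_dv hs hη.1.1) (contDiffOn_du hs h.smooth)).congr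
    fun _ hq => (hη.coeff_eq hs hc h hq).2,
  (ContDiffOn.inner ℝ (contDiffOn_du hs hη.1.1) (contDiffOn_dv hs h.smooth)).congr
    fun _ hq => (hη.coeff_eq hs hc h hq).1⟩

theorem IsRotationField.coeff_ne_zero (hs : IsOpen s) (hc : IsPreconnected s)
    (h : IsKNet ψ s) (hη : IsRotationField ψ η s) (hp : p ∈ s) :
    coeffB ψ η p ≠ 0 ∧ coeffC ψ η p ≠ 0 := by
  obtain ⟨e1, e2⟩ := hη.partials_eq hs hc h hp
  constructor <;> intro h0
  · rw [h0, zero_smul] at e2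
    have := hη.1.2 p hp (e2.trans (map_zero (fderiv ℝ η p)).symm)
    simp at this
  · rw [h0, zero_smul] at e1
    have := hη.1.2 p hp (e1.trans (map_zero (fderiv ℝ η p)).symm)
    simp at this

/-- The Codazzi type equations for the coefficients `b`, `c`: the tangential part of
`η_uv = η_vu`. -/
theorem IsRotationField.coeff_pde (hs : IsOpen s) (hc : IsPreconnected s)
    (h : IsKNet ψ s) (hη : IsRotationField ψ η s) (hp : p ∈ s) :
    dv (coeffC ψ η) p * Real.sin (netAngle ψ p)
        + coeffC ψ η p * dv (netAngle ψ) p * Real.cos (netAngle ψ p)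
        + coeffB ψ η p * du (netAngle ψ) p = 0 ∧
    du (coeffB ψ η) p * Real.sin (netAngle ψ p)
        + coeffB ψ η p * du (netAngle ψ) p * Real.cos (netAngle ψ p)
        + coeffC ψ η p * dv (netAngle ψ) p = 0 := by
  obtain ⟨hb, hcc⟩ := hη.contDiffOn_coeff hs hc h
  have hP := contDiffOn_du hs h.smooth
  have hQ := contDiffOn_dv hs h.smooth
  obtain ⟨g1, g2⟩ := h.gauss_formulas hs hp
  have hQP : ⟪dv ψ p, du ψ p⟫ = Real.cos (netAngle ψ p) := by
    rw [real_inner_comm, h.inner_du_dv hp]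
  have e := dv_du_eq hs hη.1.1 hp
  rw [dv_congr hs (fun q hq => (hη.partials_eq hs hc h hq).1) hp,
    du_congr hs (fun q hq => (hη.partials_eq hs hc h hq).2) hp,
    dv_smul (diffAt hs hcc hp) (diffAt hs hQ hp),
    du_smul (diffAt hs hb hp) (diffAt hs hP hp)] at e
  have e1 := congrArg (fun z => Real.sin (netAngle ψ p) • z) e
  simp only [smul_add, smul_comm (Real.sin (netAngle ψ p)), g1, g2] at e1
  have i1 := congrArg (fun z => ⟪z, du ψ p⟫) e1
  have i2 := congrArg (fun z => ⟪z, dv ψ p⟫) e1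
  simp only [inner_add_left, inner_sub_left, inner_smul_left, conj_trivial, h.inner_du_du hp,
    h.inner_dv_dv hp, h.inner_du_dv hp, hQP] at i1 i2
  have hsc := Real.sin_sq_add_cos_sq (netAngle ψ p)
  have hs0 := pow_ne_zero 2 (h.sin_pos hp).ne'
  constructor <;> apply mul_left_cancel₀ hs0 <;> rw [Real.sin_sq, mul_zero]
  · linear_combination i2 - Real.cos (netAngle ψ p) * i1
  · linear_combination Real.cos (netAngle ψ p) * i2 - i1

end Rotation

/-! ### Alignable rotation fields -/

section Alignable

variable {ψ η : ℝ × ℝ → Space} {I J : Set ℝ}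

/-- As `b`, `c` have constant signs, arc lengths and frame lengths differ by constant signs. -/
theorem IsRotationField.positive_or_negative (hI : IsOpenInterval I) (hJ : IsOpenInterval J)
    (h : IsKNet ψ (I ×ˢ J)) (hη : IsRotationField ψ η (I ×ˢ J)) (hal : IsAlignable η I J) :
    IsPositiveAlignable ψ η I J ∨ IsNegativeAlignable ψ η I J := by
  have hs := hI.isOpen_prod hJ
  have hc := hI.isPreconnected_prod hJ
  obtain ⟨hb, hcc⟩ := hη.contDiffOn_coeff hs hc h
  obtain ⟨τ, hτ, hτc⟩ := exists_const_sign_abs hc hcc.continuousOn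
    fun q hq => (hη.coeff_ne_zero hs hc h hq).2
  obtain ⟨σ, hσ, hσb⟩ := exists_const_sign_abs hc hb.continuousOn
    fun q hq => (hη.coeff_ne_zero hs hc h hq).1
  have hu : ∀ u₀ ∈ I, ∀ u₁ ∈ I, ∀ v ∈ J, uLength η u₀ u₁ v = τ * frameLength₁ ψ η u₀ u₁ v := by
    intro u₀ h0 u₁ h1 v hv
    rw [uLength, frameLength₁, ← intervalIntegral.integral_const_mul]
    refine intervalIntegral.integral_congr fun u hu => ?_
    have hq : (u, v) ∈ I ×ˢ J := ⟨hI.2.2.uIcc_subset h0 h1 hu, hv⟩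
    change ‖du η (u, v)‖ = _
    rw [(hη.partials_eq hs hc h hq).1, norm_smul, (h.2 _ hq).2.2.2.2, mul_one, Real.norm_eq_abs,
      hτc _ hq]
  have hv : ∀ v₀ ∈ J, ∀ v₁ ∈ J, ∀ u ∈ I, vLength η u v₀ v₁ = σ * frameLength₃ ψ η u v₀ v₁ := by
    intro v₀ h0 v₁ h1 u hu
    rw [vLength, frameLength₃, ← intervalIntegral.integral_const_mul]
    refine intervalIntegral.integral_congr fun v hv => ?_
    have hq : (u, v) ∈ I ×ˢ J := ⟨hu, hJ.2.2.uIcc_subset h0 h1 hv⟩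
    change ‖dv η (u, v)‖ = _
    rw [(hη.partials_eq hs hc h hq).2, norm_smul, (h.2 _ hq).2.2.2.1, mul_one, Real.norm_eq_abs,
      hσb _ hq]
  have sign_cases : ∀ {x : ℝ}, x ^ 2 = 1 → x = 1 ∨ x = -1 := fun hx => sq_eq_one_iff.1 hx
  rcases hal with hal | hal <;> rcases sign_cases hτ with rfl | rfl <;>
    rcases sign_cases hσ with rfl | rfl <;>
    first
    | left
      intro u₀ h0 u₁ h1 v₀ h2 v₁ h3 h4 h5
      have e := hal u₀ h0 u₁ h1 v₀ h2 v₁ h3 h4 h5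
      rw [hu u₀ h0 u₁ h1 v₀ h2, hu u₀ h0 u₁ h1 v₁ h3, hv v₀ h2 v₁ h3 u₀ h0,
        hv v₀ h2 v₁ h3 u₁ h1] at e
      linarith
    | right
      intro u₀ h0 u₁ h1 v₀ h2 v₁ h3 h4 h5
      have e := hal u₀ h0 u₁ h1 v₀ h2 v₁ h3 h4 h5
      rw [hu u₀ h0 u₁ h1 v₀ h2, hu u₀ h0 u₁ h1 v₁ h3, hv v₀ h2 v₁ h3 u₀ h0,
        hv v₀ h2 v₁ h3 u₁ h1] at e
      linarith

/-- Positive-alignability says that the form `c du + b dv` is closed. -/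
theorem IsRotationField.closed_of_positive (hI : IsOpenInterval I) (hJ : IsOpenInterval J)
    (h : IsKNet ψ (I ×ˢ J)) (hη : IsRotationField ψ η (I ×ˢ J))
    (hal : IsPositiveAlignable ψ η I J) :
    ∀ q ∈ I ×ˢ J, dv (coeffC ψ η) q = 1 * du (coeffB ψ η) q := by
  intro q hq
  obtain ⟨hb, hcc⟩ := hη.contDiffOn_coeff (hI.isOpen_prod hJ) (hI.isPreconnected_prod hJ) h
  rw [one_mul]
  exact dv_eq_du_of_loops hI hJ hcc hb hal hq

/-- Negative-alignability says that the form `c du - b dv` is closed. -/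
theorem IsRotationField.closed_of_negative (hI : IsOpenInterval I) (hJ : IsOpenInterval J)
    (h : IsKNet ψ (I ×ˢ J)) (hη : IsRotationField ψ η (I ×ˢ J))
    (hal : IsNegativeAlignable ψ η I J) :
    ∀ q ∈ I ×ˢ J, dv (coeffC ψ η) q = -1 * du (coeffB ψ η) q := by
  intro q hq
  obtain ⟨hb, hcc⟩ := hη.contDiffOn_coeff (hI.isOpen_prod hJ) (hI.isPreconnected_prod hJ) h
  rw [neg_one_mul, ← du_neg]
  refine dv_eq_du_of_loops hI hJ hcc hb.neg (fun u₀ h0 u₁ h1 v₀ h2 v₁ h3 h4 h5 => ?_) hq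
  have := hal u₀ h0 u₁ h1 v₀ h2 v₁ h3 h4 h5
  simp only [frameLength₁, frameLength₃] at this
  simp only [intervalIntegral.integral_neg]
  linarith

end Alignable

/-! ### The coefficients of alignable rotation fields -/

section Coefficients

variable {ψ η : ℝ × ℝ → Space} {s : Set (ℝ × ℝ)} {σ : ℝ}

/-- `(1 - σ cos ω) / 2`, which is `sin² (ω / 2)` for `σ = 1` and `cos² (ω / 2)` for `σ = -1`. -/
def halfSq (ψ : ℝ × ℝ → Space) (σ : ℝ) (p : ℝ × ℝ) : ℝ := (1 - σ * Real.cos (netAngle ψ p)) / 2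

theorem halfSq_one (p : ℝ × ℝ) : halfSq ψ 1 p = Real.sin (netAngle ψ p / 2) ^ 2 := by
  rw [halfSq, Real.sin_sq_eq_half_sub, mul_div_cancel₀ _ two_ne_zero]; ring

theorem halfSq_neg_one (p : ℝ × ℝ) : halfSq ψ (-1) p = Real.cos (netAngle ψ p / 2) ^ 2 := by
  rw [halfSq, Real.cos_sq, mul_div_cancel₀ _ two_ne_zero]; ring

theorem contDiffOn_halfSq (hs : IsOpen s) (h : IsKNet ψ s) (σ : ℝ) :
    ContDiffOn ℝ ∞ (halfSq ψ σ) s :=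
  (contDiffOn_const.sub (contDiffOn_const.mul (h.contDiffOn_netAngle hs).cos)).div_const 2

theorem partials_halfSq (hs : IsOpen s) (h : IsKNet ψ s) (σ : ℝ) {p : ℝ × ℝ} (hp : p ∈ s) :
    du (halfSq ψ σ) p = σ * Real.sin (netAngle ψ p) * du (netAngle ψ) p / 2 ∧
    dv (halfSq ψ σ) p = σ * Real.sin (netAngle ψ p) * dv (netAngle ψ) p / 2 := by
  have hω := h.contDiffOn_netAngle hs
  have hd := ((((diffAt hs hω hp).hasFDerivAt.cos.const_mul σ).const_sub 1).mul_const (1 / 2))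
  have he : halfSq ψ σ = fun q => (1 - σ * Real.cos (netAngle ψ q)) * (1 / 2) := by
    funext q; rw [halfSq]; ring
  constructor
  · rw [du, he, hd.fderiv, du]; simp; ring
  · rw [dv, he, hd.fderiv, dv]; simp; ring

theorem halfSq_pos (h : IsKNet ψ s) (hσ : σ ^ 2 = 1) {p : ℝ × ℝ} (hp : p ∈ s) :
    0 < halfSq ψ σ p := by
  rcases sq_eq_one_iff.1 hσ with rfl | rfl
  · rw [halfSq_one]; exact pow_pos (h.sin_half_pos hp) 2
  · rw [halfSq_neg_one]; exact pow_pos (h.cos_half_pos hp) 2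

/-- The consequences of `c_v = σ b_u`, `σ = ± 1`: with `S = (1 - σ cos ω) / 2`, the functions
`f = σ c S` and `g = b S` depend on `u` and on `v` alone, and `g ω_u = f ω_v`. -/
theorem IsRotationField.coeff_mul_halfSq (hs : IsOpen s) (hc : IsPreconnected s)
    (h : IsKNet ψ s) (hη : IsRotationField ψ η s) (hσ : σ ^ 2 = 1)
    (hcl : ∀ q ∈ s, dv (coeffC ψ η) q = σ * du (coeffB ψ η) q) {p : ℝ × ℝ} (hp : p ∈ s) :
    dv (fun q => σ * coeffC ψ η q * halfSq ψ σ q) p = 0 ∧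
    du (fun q => coeffB ψ η q * halfSq ψ σ q) p = 0 ∧
    coeffB ψ η p * halfSq ψ σ p * du (netAngle ψ) p =
      σ * coeffC ψ η p * halfSq ψ σ p * dv (netAngle ψ) p := by
  obtain ⟨hb, hcc⟩ := hη.contDiffOn_coeff hs hc h
  have hS := contDiffOn_halfSq hs h σ
  obtain ⟨e1, e2⟩ := hη.coeff_pde hs hc h hp
  have e0 := hcl p hp
  have hsin := (h.sin_pos hp).ne'
  have hsc := Real.sin_sq_add_cos_sq (netAngle ψ p)
  have hpos := (halfSq_pos h hσ hp).ne'
  -- Eliminating `c_v = σ b_u` leaves `(1 - σ cos ω) (b ω_u - σ c ω_v) = 0`.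
  have key : coeffB ψ η p * du (netAngle ψ) p = σ * coeffC ψ η p * dv (netAngle ψ) p := by
    apply mul_left_cancel₀ hpos
    rw [halfSq]
    linear_combination (1 / 2) * e1 - σ / 2 * e2 - Real.sin (netAngle ψ p) / 2 * e0
      + coeffC ψ η p * dv (netAngle ψ) p * Real.cos (netAngle ψ p) / 2 * hσ
  obtain ⟨S1, S2⟩ := partials_halfSq hs h σ hp
  refine ⟨?_, ?_, ?_⟩
  · rw [dv_mul (diffAt hs (contDiffOn_const.mul hcc) hp) (diffAt hs hS hp),
      dv_mul (differentiableAt_const σ) (diffAt hs hcc hp), dv_const, S2]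
    apply mul_left_cancel₀ hsin
    rw [halfSq]
    linear_combination
      σ / 2 * (1 - σ * Real.cos (netAngle ψ p)) * (e1 - key) +
      σ ^ 2 / 2 * coeffC ψ η p * dv (netAngle ψ) p * hsc +
      σ / 2 * coeffC ψ η p * dv (netAngle ψ) p * Real.cos (netAngle ψ p) * hσ
  · rw [du_mul (diffAt hs hb hp) (diffAt hs hS hp), S1]
    apply mul_left_cancel₀ hsin
    rw [halfSq]
    linear_combination
      1 / 2 * (1 - σ * Real.cos (netAngle ψ p)) *
        (e2 + σ * key + coeffC ψ η p * dv (netAngle ψ) p * hσ) +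
      σ / 2 * coeffB ψ η p * du (netAngle ψ) p * hsc +
      1 / 2 * coeffB ψ η p * du (netAngle ψ) p * Real.cos (netAngle ψ p) * hσ
  · linear_combination halfSq ψ σ p * key

/-- The coefficients in terms of an angle field. -/
theorem IsRotationField.exists_const_coeff (hs : IsOpen s) (hc : IsPreconnected s)
    (hne : s.Nonempty) (h : IsKNet ψ s) (hη : IsRotationField ψ η s) (hσ : σ ^ 2 = 1)
    (hcl : ∀ q ∈ s, dv (coeffC ψ η) q = σ * du (coeffB ψ η) q) {U V : ℝ × ℝ → ℝ}
    (hUV : IsAngleField ψ s U V) :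
    ∃ C : ℝ, C ≠ 0 ∧ ∀ q ∈ s, σ * coeffC ψ η q * halfSq ψ σ q * U q = C ∧
      coeffB ψ η q * halfSq ψ σ q * V q = C := by
  obtain ⟨hb, hcc⟩ := hη.contDiffOn_coeff hs hc h
  have hS := contDiffOn_halfSq hs h σ
  obtain ⟨C, hC⟩ := hUV.exists_const_mul hs hc h
    (f := fun q => σ * coeffC ψ η q * halfSq ψ σ q) (g := fun q => coeffB ψ η q * halfSq ψ σ q)
    ((contDiffOn_const.mul hcc).mul hS) (hb.mul hS)
    (fun q hq => (hη.coeff_mul_halfSq hs hc h hσ hcl hq).1)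
    (fun q hq => (hη.coeff_mul_halfSq hs hc h hσ hcl hq).2.1)
    (fun q hq => (hη.coeff_mul_halfSq hs hc h hσ hcl hq).2.2)
  refine ⟨C, ?_, hC⟩
  obtain ⟨p, hp⟩ := hne
  rw [← (hC p hp).2]
  exact mul_ne_zero (mul_ne_zero (hη.coeff_ne_zero hs hc h hp).1 (halfSq_pos h hσ hp).ne')
    (hUV.2.2 p hp).2.1

theorem IsRotationField.exists_angleField (hs : IsOpen s) (hc : IsPreconnected s)
    (h : IsKNet ψ s) (hη : IsRotationField ψ η s) (hσ : σ ^ 2 = 1)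
    (hcl : ∀ q ∈ s, dv (coeffC ψ η) q = σ * du (coeffB ψ η) q) :
    ∃ U V : ℝ × ℝ → ℝ, IsAngleField ψ s U V := by
  obtain ⟨hb, hcc⟩ := hη.contDiffOn_coeff hs hc h
  have hS := contDiffOn_halfSq hs h σ
  have hσ0 : σ ≠ 0 := by rintro rfl; norm_num at hσ
  exact ⟨_, _, isAngleField_inv hs
    (f := fun q => σ * coeffC ψ η q * halfSq ψ σ q) (g := fun q => coeffB ψ η q * halfSq ψ σ q)
    ((contDiffOn_const.mul hcc).mul hS) (hb.mul hS)
    (fun q hq => mul_ne_zero (mul_ne_zero hσ0 (hη.coeff_ne_zero hs hc h hq).2)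
      (halfSq_pos h hσ hq).ne')
    (fun q hq => mul_ne_zero (hη.coeff_ne_zero hs hc h hq).1 (halfSq_pos h hσ hq).ne')
    (fun q hq => (hη.coeff_mul_halfSq hs hc h hσ hcl hq).1)
    (fun q hq => (hη.coeff_mul_halfSq hs hc h hσ hcl hq).2.1)
    (fun q hq => (hη.coeff_mul_halfSq hs hc h hσ hcl hq).2.2)⟩

/-- The derivatives of `c` and `b` along `Y = U ∂u - V ∂v`, from `c U S` and `b V S` being
constant and `S` being a function of `ω`. -/
theorem IsRotationField.coeff_deriv_along (hs : IsOpen s) (hc : IsPreconnected s)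
    (h : IsKNet ψ s) (hη : IsRotationField ψ η s) (hσ : σ ^ 2 = 1)
    (hcl : ∀ q ∈ s, dv (coeffC ψ η) q = σ * du (coeffB ψ η) q) {U V : ℝ × ℝ → ℝ}
    (hUV : IsAngleField ψ s U V) {k : ℝ} (hk : ∀ q ∈ s, du U q = k ∧ dv V q = k)
    {p : ℝ × ℝ} (hp : p ∈ s) :
    U p * du (coeffC ψ η) p - V p * dv (coeffC ψ η) p = -k * coeffC ψ η p ∧
    U p * du (coeffB ψ η) p - V p * dv (coeffB ψ η) p = k * coeffB ψ η p := by
  obtain ⟨hb, hcc⟩ := hη.contDiffOn_coeff hs hc h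
  have hS := contDiffOn_halfSq hs h σ
  obtain ⟨hU, hV, h0⟩ := id hUV
  obtain ⟨C, -, hC⟩ := hη.exists_const_coeff hs hc ⟨p, hp⟩ h hσ hcl hUV
  have hσ0 : σ ≠ 0 := by rintro rfl; norm_num at hσ
  have hY := hUV.mul_du_eq hp
  have hS0 := (halfSq_pos h hσ hp).ne'
  obtain ⟨S1, S2⟩ := partials_halfSq hs h σ hp
  obtain ⟨hU0, hV0, hUv, hVu, -⟩ := h0 p hp
  obtain ⟨k1, k2⟩ := hk p hp
  have dS := diffAt hs hS hp
  have dc := diffAt hs hcc hp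
  have db := diffAt hs hb hp
  have dσc := (differentiableAt_const (𝕜 := ℝ) (x := p) σ).fun_mul dc
  have cu := du_congr hs (fun q hq => (hC q hq).1) hp
  have cv := dv_congr hs (fun q hq => (hC q hq).1) hp
  have bu := du_congr hs (fun q hq => (hC q hq).2) hp
  have bv := dv_congr hs (fun q hq => (hC q hq).2) hp
  rw [du_mul (dσc.fun_mul dS) (diffAt hs hU hp), du_mul dσc dS,
    du_mul (differentiableAt_const σ) dc,
    du_const, du_const, S1, k1] at cu
  rw [dv_mul (dσc.fun_mul dS) (diffAt hs hU hp), dv_mul dσc dS,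
    dv_mul (differentiableAt_const σ) dc,
    dv_const, dv_const, S2, hUv] at cv
  rw [du_mul (db.fun_mul dS) (diffAt hs hV hp), du_mul db dS, du_const, S1, hVu] at bu
  rw [dv_mul (db.fun_mul dS) (diffAt hs hV hp), dv_mul db dS, dv_const, S2, k2] at bv
  constructor
  · apply mul_left_cancel₀ (mul_ne_zero (mul_ne_zero hσ0 hS0) hU0)
    linear_combination U p * cu - V p * cv -
      σ * coeffC ψ η p * U p * (σ * Real.sin (netAngle ψ p) / 2) * hY
  · apply mul_left_cancel₀ (mul_ne_zero hS0 hV0)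
    linear_combination U p * bu - V p * bv -
      coeffB ψ η p * V p * (σ * Real.sin (netAngle ψ p) / 2) * hY

end Coefficients

/-! ### Lie derivatives of the fundamental forms -/

section Lie

variable {ψ η : ℝ × ℝ → Space} {s : Set (ℝ × ℝ)}

theorem IsAngleField.fderiv_field (hs : IsOpen s) {U V : ℝ × ℝ → ℝ}
    (hUV : IsAngleField ψ s U V) {k : ℝ} (hk : ∀ q ∈ s, du U q = k ∧ dv V q = k)
    {p : ℝ × ℝ} (hp : p ∈ s) (X : ℝ × ℝ) :
    fderiv ℝ (fun q => (U q, -V q)) p X = (k * X.1, -(k * X.2)) := by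
  obtain ⟨hU, hV, h0⟩ := hUV
  obtain ⟨k1, k2⟩ := hk p hp
  rw [((diffAt hs hU hp).hasFDerivAt.prodMk (diffAt hs hV hp).hasFDerivAt.fun_neg).fderiv]
  simp [fderiv_apply_eq, k1, k2, (h0 p hp).2.2.1, (h0 p hp).2.2.2.1, mul_comm]

theorem IsRotationField.firstForm_eq (hs : IsOpen s) (hc : IsPreconnected s)
    (h : IsKNet ψ s) (hη : IsRotationField ψ η s) {p : ℝ × ℝ} (hp : p ∈ s) (X Z : ℝ × ℝ) :
    firstForm η p X Z = coeffC ψ η p * coeffC ψ η p * (X.1 * Z.1)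
      + coeffC ψ η p * coeffB ψ η p * Real.cos (netAngle ψ p) * (X.1 * Z.2 + X.2 * Z.1)
      + coeffB ψ η p * coeffB ψ η p * (X.2 * Z.2) := by
  have hQP : ⟪dv ψ p, du ψ p⟫ = Real.cos (netAngle ψ p) := by
    rw [real_inner_comm, h.inner_du_dv hp]
  obtain ⟨e1, e2⟩ := hη.partials_eq hs hc h hp
  rw [firstForm, fderiv_apply_eq η p X, fderiv_apply_eq η p Z, e1, e2]
  simp only [inner_add_left, inner_add_right, inner_smul_left, inner_smul_right, conj_trivial,
    h.inner_du_du hp, h.inner_dv_dv hp, h.inner_du_dv hp, hQP]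
  ring

theorem secondForm_expand (hs : IsOpen s) {f : ℝ × ℝ → Space} (hf : ContDiffOn ℝ ∞ f s)
    {p : ℝ × ℝ} (hp : p ∈ s) (X Z : ℝ × ℝ) :
    secondForm f p X Z = X.1 * Z.1 * ⟪du (du f) p, unitNormal f p⟫
      + (X.1 * Z.2 + X.2 * Z.1) * ⟪du (dv f) p, unitNormal f p⟫
      + X.2 * Z.2 * ⟪dv (dv f) p, unitNormal f p⟫ := by
  have hu := diffAt hs (contDiffOn_du hs hf) hp
  have hv := diffAt hs (contDiffOn_dv hs hf) hp
  have e : (fun q => fderiv ℝ f q Z) = fun q => Z.1 • du f q + Z.2 • dv f q :=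
    funext fun q => fderiv_apply_eq f q Z
  rw [secondForm, fderiv_fderiv_apply hs hf hp, fderiv_apply_eq, e,
    du_add (hu.fun_const_smul _) (hv.fun_const_smul _),
    dv_add (hu.fun_const_smul _) (hv.fun_const_smul _),
    du_smul (differentiableAt_const _) hu, du_smul (differentiableAt_const _) hv,
    dv_smul (differentiableAt_const _) hu, dv_smul (differentiableAt_const _) hv,
    du_const, dv_const, du_const, dv_const, dv_du_eq hs hf hp]
  simp only [inner_add_left, inner_smul_left, conj_trivial, zero_smul, zero_add]
  ring

/-- The second fundamental form of a V-net is `± sin ω (c du² + b dv²)`. -/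
theorem IsRotationField.exists_secondForm_eq (hs : IsOpen s) (hc : IsPreconnected s)
    (h : IsKNet ψ s) (hη : IsRotationField ψ η s) :
    ∃ τ : ℝ, τ ^ 2 = 1 ∧ ∀ p ∈ s, ∀ X Z : ℝ × ℝ, secondForm η p X Z =
      τ * Real.sin (netAngle ψ p) *
        (coeffC ψ η p * (X.1 * Z.1) + coeffB ψ η p * (X.2 * Z.2)) := by
  obtain ⟨ε, hε, hsign⟩ := h.exists_sign hs hc
  obtain ⟨hb, hcc⟩ := hη.contDiffOn_coeff hs hc h
  have hP := contDiffOn_du hs h.smooth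
  have hQ := contDiffOn_dv hs h.smooth
  obtain ⟨τ, hτ, hcb⟩ := exists_const_sign_abs hc (hcc.mul hb).continuousOn
    fun q hq => mul_ne_zero (hη.coeff_ne_zero hs hc h hq).2 (hη.coeff_ne_zero hs hc h hq).1
  refine ⟨-(τ * ε), by linear_combination ε ^ 2 * hτ + hε, fun p hp X Z => ?_⟩
  obtain ⟨n1, n2, -⟩ := h.inner_second_normal hs hp
  have hs0 := (h.sin_pos hp).ne'
  have hn : ⟪du (dv ψ) p, cross (du ψ p) (dv ψ p)⟫ = ε * Real.sin (netAngle ψ p) ^ 2 := by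
    rw [hsign p hp, inner_smul_left, h.inner_normal hp]; rfl
  have hN : unitNormal η p =
      (-(τ * (Real.sin (netAngle ψ p))⁻¹)) • cross (du ψ p) (dv ψ p) := by
    have hcb0 : coeffC ψ η p * coeffB ψ η p ≠ 0 :=
      mul_ne_zero (hη.coeff_ne_zero hs hc h hp).2 (hη.coeff_ne_zero hs hc h hp).1
    have hτ0 : τ ≠ 0 := by rintro rfl; norm_num at hτ
    rw [unitNormal, (hη.partials_eq hs hc h hp).1, (hη.partials_eq hs hc h hp).2,
      cross_smul_smul, norm_smul, cross_swap (dv ψ p), norm_neg, h.norm_normal hp,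
      Real.norm_eq_abs, hcb p hp, smul_neg, smul_neg, smul_smul, ← neg_smul]
    congr 1
    field_simp
    rw [hτ, div_self hcb0]
  have f1 := du_congr hs (fun q hq => (hη.partials_eq hs hc h hq).1) hp
  have f2 := du_congr hs (fun q hq => (hη.partials_eq hs hc h hq).2) hp
  have f3 := dv_congr hs (fun q hq => (hη.partials_eq hs hc h hq).2) hp
  rw [du_smul (diffAt hs hcc hp) (diffAt hs hQ hp)] at f1
  rw [du_smul (diffAt hs hb hp) (diffAt hs hP hp)] at f2
  rw [dv_smul (diffAt hs hb hp) (diffAt hs hP hp), dv_du_eq hs h.smooth hp] at f3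
  rw [secondForm_expand hs hη.1.1 hp, hN, f1, f2, f3]
  simp only [inner_add_left, inner_smul_left, inner_smul_right, conj_trivial, inner_cross_left,
    inner_cross_right, n1, hn]
  field_simp
  ring

variable {U V : ℝ × ℝ → ℝ} {k : ℝ}

theorem IsRotationField.lieDeriv_firstForm (hs : IsOpen s) (hc : IsPreconnected s)
    (h : IsKNet ψ s) (hη : IsRotationField ψ η s) (hUV : IsAngleField ψ s U V)
    (hk : ∀ q ∈ s, du U q = k ∧ dv V q = k) {p : ℝ × ℝ} (hp : p ∈ s)
    (hYc : U p * du (coeffC ψ η) p - V p * dv (coeffC ψ η) p = -k * coeffC ψ η p)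
    (hYb : U p * du (coeffB ψ η) p - V p * dv (coeffB ψ η) p = k * coeffB ψ η p)
    (X Z : ℝ × ℝ) :
    lieDeriv (fun q => (U q, -V q)) (firstForm η) p X Z = 0 := by
  obtain ⟨hb, hcc⟩ := hη.contDiffOn_coeff hs hc h
  have dc := diffAt hs hcc hp
  have db := diffAt hs hb hp
  have dω := h.diffAt_netAngle hs hp
  have hY := hUV.mul_du_eq hp
  rw [lieDeriv, hUV.fderiv_field hs hk hp, hUV.fderiv_field hs hk hp,
    fderiv_congr_of_eqOn hs (fun q hq => hη.firstForm_eq hs hc h hq X Z) hp, fderiv_apply_eq,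
    hη.firstForm_eq hs hc h hp, hη.firstForm_eq hs hc h hp]
  have t1 := (dc.fun_mul dc).fun_mul (differentiableAt_const (𝕜 := ℝ) (x := p) (X.1 * Z.1))
  have t2 := ((dc.fun_mul db).fun_mul dω.cos).fun_mul
    (differentiableAt_const (𝕜 := ℝ) (x := p) (X.1 * Z.2 + X.2 * Z.1))
  have t3 := (db.fun_mul db).fun_mul (differentiableAt_const (𝕜 := ℝ) (x := p) (X.2 * Z.2))
  rw [du_add (t1.fun_add t2) t3, du_add t1 t2, dv_add (t1.fun_add t2) t3, dv_add t1 t2,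
    du_mul (dc.fun_mul dc) (differentiableAt_const _),
    du_mul ((dc.fun_mul db).fun_mul dω.cos) (differentiableAt_const _),
    du_mul (db.fun_mul db) (differentiableAt_const _), du_mul (dc.fun_mul db) dω.cos,
    dv_mul (dc.fun_mul dc) (differentiableAt_const _),
    dv_mul ((dc.fun_mul db).fun_mul dω.cos) (differentiableAt_const _),
    dv_mul (db.fun_mul db) (differentiableAt_const _), dv_mul (dc.fun_mul db) dω.cos,
    du_mul dc dc, du_mul dc db, du_mul db db, dv_mul dc dc, dv_mul dc db, dv_mul db db,
    du_cos dω, dv_cos dω]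
  simp only [du_const, dv_const, smul_eq_mul]
  linear_combination
    (2 * coeffC ψ η p * (X.1 * Z.1) + coeffB ψ η p * Real.cos (netAngle ψ p) *
      (X.1 * Z.2 + X.2 * Z.1)) * hYc +
    (2 * coeffB ψ η p * (X.2 * Z.2) + coeffC ψ η p * Real.cos (netAngle ψ p) *
      (X.1 * Z.2 + X.2 * Z.1)) * hYb -
    coeffC ψ η p * coeffB ψ η p * Real.sin (netAngle ψ p) * (X.1 * Z.2 + X.2 * Z.1) * hY

/-- The Lie derivative of `τ sin ω (c du² + b dv²)` is `k τ sin ω (c du² - b dv²)`. -/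
theorem IsRotationField.exists_lieDeriv_secondForm (hs : IsOpen s) (hc : IsPreconnected s)
    (h : IsKNet ψ s) (hη : IsRotationField ψ η s) (hUV : IsAngleField ψ s U V)
    (hk : ∀ q ∈ s, du U q = k ∧ dv V q = k)
    (hYc : ∀ p ∈ s, U p * du (coeffC ψ η) p - V p * dv (coeffC ψ η) p = -k * coeffC ψ η p)
    (hYb : ∀ p ∈ s, U p * du (coeffB ψ η) p - V p * dv (coeffB ψ η) p = k * coeffB ψ η p) :
    ∃ τ : ℝ, τ ^ 2 = 1 ∧ ∀ p ∈ s, ∀ X Z : ℝ × ℝ,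
      lieDeriv (fun q => (U q, -V q)) (secondForm η) p X Z =
        k * (τ * Real.sin (netAngle ψ p) *
          (coeffC ψ η p * (X.1 * Z.1) - coeffB ψ η p * (X.2 * Z.2))) := by
  obtain ⟨hb, hcc⟩ := hη.contDiffOn_coeff hs hc h
  obtain ⟨τ, hτ, hII⟩ := hη.exists_secondForm_eq hs hc h
  refine ⟨τ, hτ, fun p hp X Z => ?_⟩
  have dc := diffAt hs hcc hp
  have db := diffAt hs hb hp
  have dω := h.diffAt_netAngle hs hp
  have hY := hUV.mul_du_eq hp
  rw [lieDeriv, hUV.fderiv_field hs hk hp, hUV.fderiv_field hs hk hp,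
    fderiv_congr_of_eqOn hs (fun q hq => hII q hq X Z) hp, fderiv_apply_eq, hII p hp, hII p hp]
  have cst : ∀ a : ℝ, DifferentiableAt ℝ (fun _ : ℝ × ℝ => a) p := differentiableAt_const
  have t1 := (cst τ).fun_mul dω.sin
  have t2 := dc.fun_mul (cst (X.1 * Z.1))
  have t3 := db.fun_mul (cst (X.2 * Z.2))
  rw [du_mul t1 (t2.fun_add t3), dv_mul t1 (t2.fun_add t3), du_add t2 t3, dv_add t2 t3,
    du_mul (cst _) dω.sin, dv_mul (cst _) dω.sin, du_mul dc (cst _), du_mul db (cst _),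
    dv_mul dc (cst _), dv_mul db (cst _), du_sin dω, dv_sin dω]
  simp only [du_const, dv_const, smul_eq_mul]
  linear_combination
    τ * Real.sin (netAngle ψ p) * (X.1 * Z.1) * hYc p hp +
    τ * Real.sin (netAngle ψ p) * (X.2 * Z.2) * hYb p hp +
    τ * Real.cos (netAngle ψ p) *
      (coeffC ψ η p * (X.1 * Z.1) + coeffB ψ η p * (X.2 * Z.2)) * hY

end Lie

/-! ### Helicoidal K-nets -/

section Helicoidal

variable {ψ : ℝ × ℝ → Space} {s : Set (ℝ × ℝ)}

/-- If `a × ψ + d = x ψ_u + y ψ_v`, then the tangential part of `a` is `ε (x ψ_u - y ψ_v)`. -/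
theorem IsKNet.inner_rotation_axis (hs : IsOpen s) (h : IsKNet ψ s) {ε : ℝ}
    (hsign : ∀ q ∈ s, du (dv ψ) q = ε • cross (du ψ q) (dv ψ q)) {a d : Space}
    (htan : ∀ q ∈ s, ∃ X : ℝ × ℝ, fderiv ℝ ψ q X = cross a (ψ q) + d)
    {p : ℝ × ℝ} (hp : p ∈ s) {X : ℝ × ℝ} (hX : fderiv ℝ ψ p X = cross a (ψ p) + d) :
    ⟪a, du ψ p⟫ = ε * (X.1 - Real.cos (netAngle ψ p) * X.2) ∧
    ⟪a, dv ψ p⟫ = ε * (Real.cos (netAngle ψ p) * X.1 - X.2) := by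
  have hP := contDiffOn_du hs h.smooth
  have hQ := contDiffOn_dv hs h.smooth
  have dψ := diffAt hs h.smooth hp
  have dP := diffAt hs hP hp
  have dQ := diffAt hs hQ hp
  have dn := diffAt hs (contDiffOn_cross hP hQ) hp
  have da : DifferentiableAt ℝ (fun _ : ℝ × ℝ => a) p := differentiableAt_const a
  have dd : DifferentiableAt ℝ (fun _ : ℝ × ℝ => d) p := differentiableAt_const d
  have dW0 : DifferentiableAt ℝ (fun q => cross a (ψ q)) p :=
    (crossL a).differentiableAt.comp p dψ
  have dW := dW0.fun_add dd
  have hQP : ⟪dv ψ p, du ψ p⟫ = Real.cos (netAngle ψ p) := by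
    rw [real_inner_comm, h.inner_du_dv hp]
  have hWn : ∀ q ∈ s, ⟪cross a (ψ q) + d, cross (du ψ q) (dv ψ q)⟫ = 0 := by
    intro q hq
    obtain ⟨X, hX⟩ := htan q hq
    rw [← hX, fderiv_apply_eq, inner_add_left, inner_smul_left, inner_smul_left,
      inner_cross_left, inner_cross_right]
    simp
  have eu := du_congr hs hWn hp
  have ev := dv_congr hs hWn hp
  have hn := h.inner_cross_second hs hp (hWn p hp)
  rw [du_inner dW dn, du_const, du_cross dP dQ, inner_add_right, hn.1, hsign p hp,
    ← crossL_apply (du ψ p) (ε • _), map_smul, crossL_apply, cross_cross_right,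
    du_add dW0 dd, du_cross da dψ, du_const, du_const, cross_zero_left, zero_add, add_zero,
    inner_cross_cross, ← hX, fderiv_apply_eq] at eu
  rw [dv_inner dW dn, dv_const, dv_cross dP dQ, inner_add_right, hn.2, dv_du_eq hs h.smooth hp,
    hsign p hp, cross_smul_left, cross_cross_left,
    dv_add dW0 dd, dv_cross da dψ, dv_const, dv_const, cross_zero_left, zero_add, add_zero,
    inner_cross_cross, ← hX, fderiv_apply_eq] at ev
  simp only [inner_add_left, inner_sub_right, inner_smul_left, inner_smul_right, conj_trivial,
    h.inner_du_du hp, h.inner_dv_dv hp, h.inner_du_dv hp, hQP] at eu ev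
  have hsc := Real.sin_sq_add_cos_sq (netAngle ψ p)
  have hs0 := pow_ne_zero 2 (h.sin_pos hp).ne'
  constructor <;> apply mul_left_cancel₀ hs0 <;> rw [Real.sin_sq]
  · linear_combination ev - Real.cos (netAngle ψ p) * eu
  · linear_combination Real.cos (netAngle ψ p) * ev - eu

/-- A nonzero Killing field tangent to a K-net has constant components in the frame
`(∂u, ∂v)`, and it annihilates the angle. -/
theorem IsKNet.exists_killing_components (hs : IsOpen s) (hc : IsPreconnected s)
    (hne : s.Nonempty) (h : IsKNet ψ s) (hel : IsHelicoidal ψ s) :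
    ∃ x y : ℝ, (x ≠ 0 ∨ y ≠ 0) ∧
      ∀ q ∈ s, x * du (netAngle ψ) q + y * dv (netAngle ψ) q = 0 := by
  obtain ⟨a, d, had, htan⟩ := hel
  obtain ⟨ε, hε, hsign⟩ := h.exists_sign hs hc
  have hω := h.contDiffOn_netAngle hs
  have hP := contDiffOn_du hs h.smooth
  have hQ := contDiffOn_dv hs h.smooth
  have hε0 : ε ≠ 0 := by rintro rfl; norm_num at hε
  have hA : ContDiffOn ℝ ∞ (fun q => ⟪a, du ψ q⟫) s := ContDiffOn.inner ℝ contDiffOn_const hP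
  have hB : ContDiffOn ℝ ∞ (fun q => ⟪a, dv ψ q⟫) s := ContDiffOn.inner ℝ contDiffOn_const hQ
  have hS : ∀ q ∈ s, Real.sin (netAngle ψ q) ^ 2 ≠ 0 := fun q hq => pow_ne_zero 2 (h.sin_pos hq).ne'
  -- `x` and `y` are solved from `a·ψ_u`, `a·ψ_v`, so that they are visibly smooth.
  set x : ℝ × ℝ → ℝ := fun q =>
    ε * (⟪a, du ψ q⟫ - Real.cos (netAngle ψ q) * ⟪a, dv ψ q⟫) / Real.sin (netAngle ψ q) ^ 2 with hx
  set y : ℝ × ℝ → ℝ := fun q =>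
    ε * (Real.cos (netAngle ψ q) * ⟪a, du ψ q⟫ - ⟪a, dv ψ q⟫) / Real.sin (netAngle ψ q) ^ 2 with hy
  have hxs : ContDiffOn ℝ ∞ x s :=
    (contDiffOn_const.mul (hA.sub (hω.cos.mul hB))).div (hω.sin.pow 2) hS
  have hys : ContDiffOn ℝ ∞ y s :=
    (contDiffOn_const.mul ((hω.cos.mul hA).sub hB)).div (hω.sin.pow 2) hS
  have hxy : ∀ q ∈ s, cross a (ψ q) + d = x q • du ψ q + y q • dv ψ q ∧
      ⟪a, du ψ q⟫ = ε * (x q - Real.cos (netAngle ψ q) * y q) ∧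
      ⟪a, dv ψ q⟫ = ε * (Real.cos (netAngle ψ q) * x q - y q) := by
    intro q hq
    obtain ⟨X, hX⟩ := htan q hq
    obtain ⟨i1, i2⟩ := h.inner_rotation_axis hs hsign htan hq hX
    have hsc := Real.sin_sq_add_cos_sq (netAngle ψ q)
    have ex : x q = X.1 := by
      rw [hx]
      simp only
      rw [i1, i2, div_eq_iff (hS q hq), Real.sin_sq]
      linear_combination X.1 * (1 - Real.cos (netAngle ψ q) ^ 2) * hε
    have ey : y q = X.2 := by
      rw [hy]
      simp only
      rw [i1, i2, div_eq_iff (hS q hq), Real.sin_sq]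
      linear_combination X.2 * (1 - Real.cos (netAngle ψ q) ^ 2) * hε
    rw [ex, ey, ← hX, fderiv_apply_eq]
    exact ⟨rfl, i1, i2⟩
  have key : ∀ q ∈ s, du x q = 0 ∧ dv x q = 0 ∧ du y q = 0 ∧ dv y q = 0 ∧
      x q * du (netAngle ψ) q + y q * dv (netAngle ψ) q = 0 ∧
      ⟪a, cross (du ψ q) (dv ψ q)⟫ =
        -x q * du (netAngle ψ) q * Real.sin (netAngle ψ q) := by
    intro q hq
    have dψ := diffAt hs h.smooth hq
    have dP := diffAt hs hP hq
    have dQ := diffAt hs hQ hq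
    have dω := diffAt hs hω hq
    have dx := diffAt hs hxs hq
    have dy := diffAt hs hys hq
    have da : DifferentiableAt ℝ (fun _ : ℝ × ℝ => a) q := differentiableAt_const a
    have dd : DifferentiableAt ℝ (fun _ : ℝ × ℝ => d) q := differentiableAt_const d
    have dε : DifferentiableAt ℝ (fun _ : ℝ × ℝ => ε) q := differentiableAt_const ε
    have dW0 : DifferentiableAt ℝ (fun q => cross a (ψ q)) q :=
      (crossL a).differentiableAt.comp q dψ
    have hQP : ⟪dv ψ q, du ψ q⟫ = Real.cos (netAngle ψ q) := by
      rw [real_inner_comm, h.inner_du_dv hq]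
    have hs0 := (h.sin_pos hq).ne'
    obtain ⟨s1, s2, s3, s4, s5, s6⟩ := h.inner_second hs hq
    have eu := du_congr hs (fun q hq => (hxy q hq).1) hq
    have ev := dv_congr hs (fun q hq => (hxy q hq).1) hq
    rw [du_add dW0 dd, du_cross da dψ, du_const, du_const, cross_zero_left, zero_add, add_zero,
      du_add (dx.fun_smul dP) (dy.fun_smul dQ), du_smul dx dP, du_smul dy dQ] at eu
    rw [dv_add dW0 dd, dv_cross da dψ, dv_const, dv_const, cross_zero_left, zero_add, add_zero,
      dv_add (dx.fun_smul dP) (dy.fun_smul dQ), dv_smul dx dP, dv_smul dy dQ,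
      dv_du_eq hs h.smooth hq] at ev
    have u1 := congrArg (fun z => ⟪z, du ψ q⟫) eu
    have u2 := congrArg (fun z => ⟪z, dv ψ q⟫) eu
    have v1 := congrArg (fun z => ⟪z, du ψ q⟫) ev
    have v2 := congrArg (fun z => ⟪z, dv ψ q⟫) ev
    simp only [inner_add_left, inner_smul_left, conj_trivial, h.inner_du_du hq, h.inner_dv_dv hq,
      h.inner_du_dv hq, hQP, s1, s2, s3, s4, s5, s6, real_inner_comm (du ψ q) (cross _ _),
      real_inner_comm (dv ψ q) (cross _ _), inner_cross_right] at u1 u2 v1 v2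
    have c1 : ⟪dv ψ q, cross a (du ψ q)⟫ = ⟪a, cross (du ψ q) (dv ψ q)⟫ := by
      rw [← inner_cross_rotate]
    have c2 : ⟪du ψ q, cross a (dv ψ q)⟫ = -⟪a, cross (du ψ q) (dv ψ q)⟫ := by
      rw [← inner_cross_rotate, inner_cross_swap]
    rw [c1] at u2
    rw [c2] at v1
    have bu := du_congr hs (fun q hq => (hxy q hq).2.2) hq
    have av := dv_congr hs (fun q hq => (hxy q hq).2.1) hq
    rw [du_inner da dQ, du_const, inner_zero_left, zero_add, hsign q hq, inner_smul_right,
      du_mul dε ((dω.cos.fun_mul dx).fun_sub dy), du_const, zero_mul, zero_add,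
      du_sub (dω.cos.fun_mul dx) dy, du_mul dω.cos dx, du_cos dω] at bu
    rw [dv_inner da dP, dv_const, inner_zero_left, zero_add, dv_du_eq hs h.smooth hq, hsign q hq,
      inner_smul_right,
      dv_mul dε (dx.fun_sub (dω.cos.fun_mul dy)), dv_const, zero_mul, zero_add,
      dv_sub dx (dω.cos.fun_mul dy), dv_mul dω.cos dy, dv_cos dω] at av
    have bu' := mul_left_cancel₀ hε0 bu
    have av' := mul_left_cancel₀ hε0 av
    -- The derivatives of `a·ψ_v`, `a·ψ_u` repeat those of the tangency relation with the opposite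
    -- sign at `y_u`, `x_v`.
    have yu : du y q = 0 := by linarith
    have xv : dv x q = 0 := by linarith
    rw [yu] at u1 u2
    rw [xv] at v1 v2
    have xu : du x q = 0 := by linarith
    have yv : dv y q = 0 := by linarith
    rw [xu] at u2
    rw [yv] at v1
    refine ⟨xu, xv, yu, yv, ?_, by linarith⟩
    apply mul_left_cancel₀ hs0
    linarith
  obtain ⟨x0, hx0⟩ := exists_const_of_partials_eq_zero hs hc hxs
    (fun q hq => (key q hq).1) (fun q hq => (key q hq).2.1)
  obtain ⟨y0, hy0⟩ := exists_const_of_partials_eq_zero hs hc hys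
    (fun q hq => (key q hq).2.2.1) (fun q hq => (key q hq).2.2.2.1)
  refine ⟨x0, y0, ?_, fun q hq => ?_⟩
  · by_contra! h00
    obtain ⟨rfl, rfl⟩ := h00
    obtain ⟨p, hp⟩ := hne
    obtain ⟨w, i1, i2⟩ := hxy p hp
    have i3 := (key p hp).2.2.2.2.2
    rw [hx0 p hp, hy0 p hp] at w i1 i2
    rw [hx0 p hp] at i3
    have ha : a = 0 := h.ext_inner hp (by rw [i1]; simp) (by rw [i2]; simp) (by rw [i3]; simp)
    rw [ha, cross_zero_left] at w
    rcases had with h1 | h1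
    · exact h1 ha
    · exact h1 (by simpa using w)
  · have := (key q hq).2.2.2.2.1
    rwa [hx0 q hq, hy0 q hq] at this

/-- The Killing field `x ∂u + y ∂v` has to be a multiple of `Y = U ∂u - V ∂v`, so `U`, `V` are
constant. -/
theorem IsAngleField.eq_zero_of_helicoidal (hs : IsOpen s) (hc : IsPreconnected s)
    (hne : s.Nonempty) (h : IsKNet ψ s) {U V : ℝ × ℝ → ℝ} (hUV : IsAngleField ψ s U V) {k : ℝ}
    (hk : ∀ q ∈ s, du U q = k ∧ dv V q = k) (hel : IsHelicoidal ψ s) : k = 0 := by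
  obtain ⟨x, y, hxy, hω⟩ := h.exists_killing_components hs hc hne hel
  obtain ⟨hU, hV, h0⟩ := id hUV
  have hz : ∀ q ∈ s, x * V q + y * U q = 0 := by
    refine h.eq_zero_of_mul_dv hs hc
      ((contDiffOn_const.mul hV).add (contDiffOn_const.mul hU)) fun q hq => ?_
    linear_combination U q * hω q hq - x * hUV.mul_du_eq hq
  obtain ⟨p, hp⟩ := hne
  have dU := diffAt hs hU hp
  have dV := diffAt hs hV hp
  have dc : ∀ c : ℝ, DifferentiableAt ℝ (fun _ : ℝ × ℝ => c) p := differentiableAt_const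
  have eu := du_congr hs hz hp
  have ev := dv_congr hs hz hp
  rw [du_add ((dc x).fun_mul dV) ((dc y).fun_mul dU), du_mul (dc x) dV, du_mul (dc y) dU,
    du_const, du_const, du_const, (hk p hp).1, (h0 p hp).2.2.2.1] at eu
  rw [dv_add ((dc x).fun_mul dV) ((dc y).fun_mul dU), dv_mul (dc x) dV, dv_mul (dc y) dU,
    dv_const, dv_const, dv_const, (hk p hp).2, (h0 p hp).2.2.1] at ev
  have e1 : y * k = 0 := by linarith
  have e2 : x * k = 0 := by linarith
  rcases hxy with h1 | h1
  · simpa [h1] using e2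
  · simpa [h1] using e1

end Helicoidal

/-! ### Amsler surfaces -/

section Amsler

variable {ψ : ℝ × ℝ → Space} {I J : Set ℝ}

/-- A vector orthogonal to a unit vector vanishes if both are parallel to the same nonzero
vector. -/
theorem eq_zero_of_cross_eq_zero {w P R : Space} (hw : w ≠ 0) (hP : ⟪P, P⟫ = 1)
    (hPR : ⟪R, P⟫ = 0) (h1 : cross w P = 0) (h2 : cross w R = 0) : R = 0 := by
  have a1 := inner_cross_cross w P w P
  have a2 := inner_cross_cross w R w P
  have a3 := inner_cross_cross w R w R
  rw [h1, inner_zero_left, real_inner_comm w P, hP] at a1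
  rw [h2, inner_zero_left, hPR, real_inner_comm w R] at a2
  rw [h2, inner_zero_left, real_inner_comm w R] at a3
  have hw0 : ⟪w, w⟫ ≠ 0 := inner_self_ne_zero.2 hw
  have b1 : ⟪w, P⟫ ≠ 0 := by
    intro h0; rw [h0] at a1; apply hw0; linarith
  have b2 : ⟪w, R⟫ = 0 := by
    have : ⟪w, P⟫ * ⟪w, R⟫ = 0 := by linarith
    simpa [b1] using this
  rw [b2] at a3
  have : ⟪w, w⟫ * ⟪R, R⟫ = 0 := by linarith
  simpa [hw] using this

/-- A unit speed parametrization of a part of a straight line has no acceleration. -/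
theorem second_deriv_eq_zero_of_collinear (hI : IsOpen I) {γ P R : ℝ → Space}
    (hγ : ∀ t ∈ I, HasDerivAt γ (P t) t) (hP : ∀ t ∈ I, HasDerivAt P (R t) t)
    (hPP : ∀ t ∈ I, ⟪P t, P t⟫ = 1) (hRP : ∀ t ∈ I, ⟪R t, P t⟫ = 0)
    (hcol : Collinear ℝ (γ '' I)) : ∀ t ∈ I, R t = 0 := by
  have huniq : ∀ {f : ℝ → Space} {f' : Space} {t : ℝ}, t ∈ I → HasDerivAt f f' t →
      (∀ x ∈ I, f x = 0) → f' = 0 := fun {f f' t} ht hf h0 =>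
    hf.unique ((hasDerivAt_const t (0 : Space)).congr_of_eventuallyEq
      (Filter.eventuallyEq_of_mem (hI.mem_nhds ht) h0))
  obtain ⟨p₀, w, hw⟩ := (collinear_iff_exists_forall_eq_smul_vadd (k := ℝ) _).1 hcol
  have hlin : ∀ t ∈ I, ∃ r : ℝ, γ t = r • w + p₀ := fun t ht => hw (γ t) ⟨t, ht, rfl⟩
  have h1 : ∀ t ∈ I, cross w (P t) = 0 := fun t ht =>
    huniq ht ((crossL w).hasFDerivAt.comp_hasDerivAt t ((hγ t ht).sub_const p₀)) fun x hx => by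
      obtain ⟨r, hr⟩ := hlin x hx
      change cross w (γ x - p₀) = 0
      rw [hr, add_sub_cancel_right]
      apply space_ext <;> simp [cross_coord] <;> ring
  intro t ht
  have h2 : cross w (R t) = 0 :=
    huniq ht ((crossL w).hasFDerivAt.comp_hasDerivAt t (hP t ht)) h1
  refine eq_zero_of_cross_eq_zero ?_ (hPP t ht) (hRP t ht) (h1 t ht) h2
  rintro rfl
  have h3 : P t = 0 := huniq ht ((hγ t ht).sub_const p₀) fun x hx => by
    obtain ⟨r, hr⟩ := hlin x hx
    change γ x - p₀ = 0
    rw [hr]; simp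
  have h4 := hPP t ht
  rw [h3] at h4
  simp at h4

/-- The angle is constant along straight coordinate lines. -/
theorem IsKNet.du_netAngle_eq_zero_of_collinear (hI : IsOpenInterval I) (hJ : IsOpenInterval J)
    (h : IsKNet ψ (I ×ˢ J)) {v : ℝ} (hv : v ∈ J)
    (hcol : Collinear ℝ ((fun u => ψ (u, v)) '' I)) {u : ℝ} (hu : u ∈ I) :
    du (netAngle ψ) (u, v) = 0 := by
  have hs := hI.isOpen_prod hJ
  have hmem : ∀ u ∈ I, (u, v) ∈ I ×ˢ J := fun u hu => ⟨hu, hv⟩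
  have hR := second_deriv_eq_zero_of_collinear hI.2.1
    (fun u hu => hasDerivAt_du (diffAt hs h.smooth (hmem u hu)))
    (fun u hu => hasDerivAt_du (h.diffAt_du hs (hmem u hu)))
    (fun u hu => h.inner_du_du (hmem u hu))
    (fun u hu => (h.inner_second hs (hmem u hu)).1) hcol u hu
  obtain ⟨-, -, -, -, e, -⟩ := h.inner_second hs (hmem u hu)
  rw [hR, inner_zero_left] at e
  simpa [(h.sin_pos (hmem u hu)).ne'] using e

theorem IsKNet.dv_netAngle_eq_zero_of_collinear (hI : IsOpenInterval I) (hJ : IsOpenInterval J)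
    (h : IsKNet ψ (I ×ˢ J)) {u : ℝ} (hu : u ∈ I)
    (hcol : Collinear ℝ ((fun v => ψ (u, v)) '' J)) {v : ℝ} (hv : v ∈ J) :
    dv (netAngle ψ) (u, v) = 0 := by
  have hs := hI.isOpen_prod hJ
  have hmem : ∀ v ∈ J, (u, v) ∈ I ×ˢ J := fun v hv => ⟨hu, hv⟩
  have hR := second_deriv_eq_zero_of_collinear hJ.2.1
    (fun v hv => hasDerivAt_dv (diffAt hs h.smooth (hmem v hv)))
    (fun v hv => hasDerivAt_dv (h.diffAt_dv hs (hmem v hv)))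
    (fun v hv => h.inner_dv_dv (hmem v hv))
    (fun v hv => (h.inner_second hs (hmem v hv)).2.2.2.1) hcol v hv
  obtain ⟨-, -, -, -, -, e⟩ := h.inner_second hs (hmem v hv)
  rw [hR, inner_zero_left] at e
  simpa [(h.sin_pos (hmem v hv)).ne'] using e

/-- On an Amsler surface the angle is a function of `(u - u₀) (v - v₀)`:
`D = (u - u₀) ω_u - (v - v₀) ω_v` solves `D_uv = cos ω D` and vanishes on the straight lines. -/
theorem IsAmsler.exists_angle_eq (hI : IsOpenInterval I) (hJ : IsOpenInterval J)
    (h : IsAmsler ψ I J) : ∃ u₀ v₀ : ℝ, ∀ q ∈ I ×ˢ J,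
      (q.1 - u₀) * du (netAngle ψ) q = (q.2 - v₀) * dv (netAngle ψ) q := by
  obtain ⟨I', J', hI', hJ', hII, hJJ, ψ', h', heq, u₀, hu₀, v₀, hv₀, hcol1, hcol2⟩ := h
  have hs := hI.isOpen_prod hJ
  have hs' := hI'.isOpen_prod hJ'
  have hc' := hI'.isPreconnected_prod hJ'
  have hω := h'.contDiffOn_netAngle hs'
  have hA : ContDiffOn ℝ ∞ (fun q : ℝ × ℝ => q.1 - u₀) (I' ×ˢ J') := by fun_prop
  have hB : ContDiffOn ℝ ∞ (fun q : ℝ × ℝ => q.2 - v₀) (I' ×ˢ J') := by fun_prop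
  have hD := goursat_unique hI' hJ'
    (D := fun q => (q.1 - u₀) * du (netAngle ψ') q - (q.2 - v₀) * dv (netAngle ψ') q)
    ((hA.mul (contDiffOn_du hs' hω)).sub (hB.mul (contDiffOn_dv hs' hω))) (K := 1)
    (fun q hq => by
      rw [h'.dv_du_angle_deriv hs' hc' hA hB (fun _ _ => dv_fst u₀) (fun _ _ => du_snd v₀) hq,
        du_fst, dv_snd, sub_self, zero_mul, zero_add, abs_mul]
      exact mul_le_mul_of_nonneg_right (Real.abs_cos_le_one _) (abs_nonneg _))
    hu₀ hv₀
    (fun u hu => by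
      simp [h'.du_netAngle_eq_zero_of_collinear hI' hJ' hv₀ hcol1 hu])
    (fun v hv => by
      simp [h'.dv_netAngle_eq_zero_of_collinear hI' hJ' hu₀ hcol2 hv])
  refine ⟨u₀, v₀, fun q hq => ?_⟩
  have hangle : ∀ q ∈ I ×ˢ J, netAngle ψ q = netAngle ψ' q := fun q hq => by
    rw [netAngle, netAngle, du_congr hs heq hq, dv_congr hs heq hq]
  rw [du_congr hs hangle hq, dv_congr hs hangle hq]
  exact sub_eq_zero.1 (hD q ⟨hII hq.1, hJJ hq.2⟩)

/-- If `k = 0`, comparing `U ω_u = V ω_v` with `(u - u₀) ω_u = (v - v₀) ω_v` makes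
`(u - u₀) V = (v - v₀) U` for nonzero constants `U`, `V`. -/
theorem IsAngleField.ne_zero_of_amsler (hI : IsOpenInterval I) (hJ : IsOpenInterval J)
    (h : IsKNet ψ (I ×ˢ J)) {U V : ℝ × ℝ → ℝ} (hUV : IsAngleField ψ (I ×ˢ J) U V) {k : ℝ}
    (hk : ∀ q ∈ I ×ˢ J, du U q = k ∧ dv V q = k) (ham : IsAmsler ψ I J) : k ≠ 0 := by
  rintro rfl
  obtain ⟨u₀, v₀, hω⟩ := ham.exists_angle_eq hI hJ
  have hs := hI.isOpen_prod hJ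
  obtain ⟨hU, hV, h0⟩ := id hUV
  have hA : ContDiffOn ℝ ∞ (fun q : ℝ × ℝ => q.1 - u₀) (I ×ˢ J) := by fun_prop
  have hB : ContDiffOn ℝ ∞ (fun q : ℝ × ℝ => q.2 - v₀) (I ×ˢ J) := by fun_prop
  have hz : ∀ q ∈ I ×ˢ J, (q.1 - u₀) * V q - (q.2 - v₀) * U q = 0 := by
    refine h.eq_zero_of_mul_dv hs (hI.isPreconnected_prod hJ)
      ((hA.mul hV).sub (hB.mul hU)) fun q hq => ?_
    linear_combination U q * hω q hq - (q.1 - u₀) * hUV.mul_du_eq hq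
  obtain ⟨p, hp⟩ : (I ×ˢ J).Nonempty := hI.1.prod hJ.1
  have dU := diffAt hs hU hp
  have dV := diffAt hs hV hp
  have e := du_congr hs hz hp
  rw [du_sub ((diffAt hs hA hp).fun_mul dV) ((diffAt hs hB hp).fun_mul dU),
    du_mul (diffAt hs hA hp) dV, du_mul (diffAt hs hB hp) dU, du_fst, du_snd, du_const,
    (hk p hp).1, (h0 p hp).2.2.2.1] at e
  exact (h0 p hp).2.1 (by linarith)

end Amsler

end

end Voss

theorem mainTheorem8 (I J : Set ℝ) (hI : Voss.IsOpenInterval I) (hJ : Voss.IsOpenInterval J)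
    (ψ η : ℝ × ℝ → Voss.Space) (hψ : Voss.IsKNet ψ (I ×ˢ J))
    (hη : Voss.IsRotationField ψ η (I ×ˢ J)) (halign : Voss.IsAlignable η I J) :
    (∀ p ∈ I ×ˢ J,
      Voss.du η p = Voss.coeffC ψ η p • Voss.dv ψ p ∧
      Voss.dv η p = Voss.coeffB ψ η p • Voss.du ψ p) ∧
    (Voss.IsPositiveAlignable ψ η I J ∨ Voss.IsNegativeAlignable ψ η I J) ∧
    (∃ U V : ℝ × ℝ → ℝ, Voss.IsAngleField ψ (I ×ˢ J) U V) ∧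
    ∀ U V : ℝ × ℝ → ℝ, Voss.IsAngleField ψ (I ×ˢ J) U V →
      (Voss.IsPositiveAlignable ψ η I J → ∃ C : ℝ, C ≠ 0 ∧ ∀ p ∈ I ×ˢ J,
        Voss.coeffB ψ η p = C / V p * (1 / Real.sin (Voss.netAngle ψ p / 2) ^ 2) ∧
        Voss.coeffC ψ η p = C / U p * (1 / Real.sin (Voss.netAngle ψ p / 2) ^ 2)) ∧
      (Voss.IsNegativeAlignable ψ η I J → ∃ C : ℝ, C ≠ 0 ∧ ∀ p ∈ I ×ˢ J,
        Voss.coeffB ψ η p = C / V p * (1 / Real.cos (Voss.netAngle ψ p / 2) ^ 2) ∧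
        Voss.coeffC ψ η p = -(C / U p) * (1 / Real.cos (Voss.netAngle ψ p / 2) ^ 2)) ∧
      ∃ k : ℝ,
        (∀ p ∈ I ×ˢ J, Voss.du U p = k ∧ Voss.dv V p = k ∧ Voss.dv U p = 0 ∧ Voss.du V p = 0) ∧
        (Voss.IsHelicoidal ψ (I ×ˢ J) → k = 0) ∧
        (Voss.IsAmsler ψ I J → k ≠ 0) ∧
        (∀ p ∈ I ×ˢ J, ∀ X Z : ℝ × ℝ,
          Voss.lieDeriv (fun q => (U q, -V q)) (Voss.firstForm η) p X Z = 0) ∧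
        (k = 0 → ∀ p ∈ I ×ˢ J, ∀ X Z : ℝ × ℝ,
          Voss.lieDeriv (fun q => (U q, -V q)) (Voss.secondForm η) p X Z = 0) ∧
        (k ≠ 0 → ∀ p ∈ I ×ˢ J, ∃ X Z : ℝ × ℝ,
          Voss.lieDeriv (fun q => (U q, -V q)) (Voss.secondForm η) p X Z ≠ 0) := by
  have hs := hI.isOpen_prod hJ
  have hc := hI.isPreconnected_prod hJ
  have hne : (I ×ˢ J).Nonempty := hI.1.prod hJ.1
  have hpn := hη.positive_or_negative hI hJ hψ halign
  obtain ⟨σ, hσ, hcl⟩ : ∃ σ : ℝ, σ ^ 2 = 1 ∧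
      ∀ q ∈ I ×ˢ J, Voss.dv (Voss.coeffC ψ η) q = σ * Voss.du (Voss.coeffB ψ η) q := by
    rcases hpn with hal | hal
    · exact ⟨1, by norm_num, hη.closed_of_positive hI hJ hψ hal⟩
    · exact ⟨-1, by norm_num, hη.closed_of_negative hI hJ hψ hal⟩
  refine ⟨fun p hp => hη.partials_eq hs hc hψ hp, hpn, hη.exists_angleField hs hc hψ hσ hcl,
    fun U V hUV => ⟨fun hal => ?_, fun hal => ?_, ?_⟩⟩
  · obtain ⟨C, hC0, hC⟩ := hη.exists_const_coeff hs hc hne hψ (by norm_num)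
      (hη.closed_of_positive hI hJ hψ hal) hUV
    refine ⟨C, hC0, fun p hp => ?_⟩
    obtain ⟨e1, e2⟩ := hC p hp
    have hS := (hψ.sin_half_pos hp).ne'
    have hU0 := (hUV.2.2 p hp).1
    have hV0 := (hUV.2.2 p hp).2.1
    rw [Voss.halfSq_one] at e1 e2
    constructor
    · rw [← e2]; field_simp
    · rw [← e1]; field_simp
  · obtain ⟨C, hC0, hC⟩ := hη.exists_const_coeff hs hc hne hψ (by norm_num)
      (hη.closed_of_negative hI hJ hψ hal) hUV
    refine ⟨C, hC0, fun p hp => ?_⟩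
    obtain ⟨e1, e2⟩ := hC p hp
    have hS := (hψ.cos_half_pos hp).ne'
    have hU0 := (hUV.2.2 p hp).1
    have hV0 := (hUV.2.2 p hp).2.1
    rw [Voss.halfSq_neg_one] at e1 e2
    constructor
    · rw [← e2]; field_simp
    · rw [← e1]; field_simp
  · obtain ⟨k, hk⟩ := hUV.exists_const_deriv hs hc hψ
    have hY := fun p (hp : p ∈ I ×ˢ J) => hη.coeff_deriv_along hs hc hψ hσ hcl hUV hk hp
    obtain ⟨τ, hτ, hII⟩ := hη.exists_lieDeriv_secondForm hs hc hψ hUV hk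
      (fun p hp => (hY p hp).1) (fun p hp => (hY p hp).2)
    refine ⟨k, fun p hp => ⟨(hk p hp).1, (hk p hp).2, (hUV.2.2 p hp).2.2.1,
      (hUV.2.2 p hp).2.2.2.1⟩, hUV.eq_zero_of_helicoidal hs hc hne hψ hk,
      hUV.ne_zero_of_amsler hI hJ hψ hk,
      fun p hp X Z => hη.lieDeriv_firstForm hs hc hψ hUV hk hp (hY p hp).1 (hY p hp).2 X Z,
      fun hk0 p hp X Z => by rw [hII p hp, hk0, zero_mul], fun hk0 p hp => ?_⟩
    refine ⟨(1, 0), (1, 0), ?_⟩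
    have hτ0 : τ ≠ 0 := by rintro rfl; norm_num at hτ
    rw [hII p hp]
    simp [hk0, hτ0, (hψ.sin_pos hp).ne', (hη.coeff_ne_zero hs hc hψ hp).2]
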